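/- **Theorem 5.1.** Setting. For $d\in\mathbb N$ let $D_d\subset\mathbb R^d$ be open with Lebesgue measure $\lambda_d(D_d)=1$. Let $k\in\mathbb N_0$ and let $L=(L_{j,d})_{0\le j\le k,\,d\in\mathbb N}$ be positive numbers. Let $$C^k_d(L)=\{f\in C^k(D_d)\;:\;\|f\|_\infty\le 1,\ \operatorname{Lip}(f^{(j)})\le L_{j,d}\ \text{for } j=0,1,\dots,k\},$$ where $f^{(j)}(x)$ is the $j$-th derivative, a $j$-linear form on Euclidean $\mathbb R^d$ with the operator norm, and $\operatorname{Lip}(f^{(j)})=\sup_{x\ne y\in D_d}\|f^{(j)}(x)-f^{(j)}(y)\|/\|x-y\|_2$. Let $n(\varepsilon,C^k_d(L))$ be the minimal number $n$ of (adaptively chosen) function values at points of $D_d$ for which some algorithm $\phi(f(x_1),\dots,f(x_n))$, with an arbitrary map $\phi:\mathbb R^n\to\mathbb R$, approximates $\int_{D_d}f(x)\,dx$ with error at most $\varepsilon$ for all $f\in C^k_d(L)$. The *curse of dimensionality* holds for $C^k_d(L)$ if there are $c,\varepsilon_0,\gamma>0$ such that $n(\varepsilon,C^k_d(L))\ge c\,(1+\gamma)^d$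 for all $0<\varepsilon\le\varepsilon_0$ and infinitely many $d\in\mathbb N$. (a) Assume that $D_d=(0,1)^d$ for all $d$, or that $(D_d)$ has small radius, i.e. $$\limsup_{d\to\infty}\frac{1}{\sqrt d}\,\inf_{x\in\mathbb R^d}\sup_{y\in D_d}\|y-x\|_2<\sqrt{\frac{2}{\pi e}}.$$ If $$\limsup_{d\to\infty}\ \min\bigl\{L_{0,d}\sqrt d,\ L_{1,d}\,d,\ \dots,\ L_{k,d}\,d\bigr\}>0,$$ i.e. the conditions $\limsup_{d}L_{0,d}\sqrt d>0$ and $\limsup_{d}L_{j,d}\,d>0$ for $j=1,\dots,k$ hold along a common subsequence of dimensions, then the curse of dimensionality holds for $C^k_d(L)$. (b) Assume that all $D_d$ are convex and that $(D_d)$ satisfies Property (P): there are $x_d^*\in D_d$ and $R<\infty$ with $\lim_{d\to\infty}\lambda_d(\{x\in D_d:\|x-x_d^*\|_2\ge R\sqrt d\})=0$. (In particular, this holds if $D_d=(0,1)^d$ or if $(D_d)$ has small radius.) If $j\in\{0,1,\dots,k\}$ is such that $$\lim_{d\to\infty}L_{j,d}\,d^{(j+1)/2}=0,$$ then the curse of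 dimensionality does not hold for $C^k_d(L)$; moreover, for every $\varepsilon\in(0,1)$ there is $d(\varepsilon)$ such that $n(\varepsilon,C^k_d(L))\le e^j d^j$ for all $d\ge d(\varepsilon)$. -/

import Mathlib

open Filter MeasureTheory Topology
open scoped ENNReal

namespace Integration

/-- An adaptive algorithm that uses `n` function values at points of `D`. The `m`-th sample point
(counting from `0`, `m < n`) may depend on the `m` function values computed before. -/
structure Algorithm {E : Type*} (D : Set E) (n : ℕ) where
  /-- the rule that selects the next sample point from the values seen so far -/
  point : (m : ℕ) → (Fin m → ℝ) → E
  /-- the points that are used lie in the domain -/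
  point_mem : ∀ m, m < n → ∀ v : Fin m → ℝ, point m v ∈ D
  /-- the arbitrary map that turns the computed values into the output -/
  out : (Fin n → ℝ) → ℝ

/-- The first `m` function values that the algorithm computes for the integrand `f`. -/
def Algorithm.values {E : Type*} {D : Set E} {n : ℕ} (A : Algorithm D n) (f : E → ℝ) :
    (m : ℕ) → Fin m → ℝ
  | 0 => Fin.elim0
  | m + 1 => Fin.snoc (A.values f m) (f (A.point m (A.values f m)))

/-- The output of the algorithm for the integrand `f`. -/
def Algorithm.run {E : Type*} {D : Set E} {n : ℕ} (A : Algorithm D n) (f : E → ℝ) : ℝ :=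
  A.out (A.values f n)

/-- The worst case error over the class `F` of an algorithm for integration over `D`. -/
noncomputable def Algorithm.error {E : Type*} [MeasureSpace E] {D : Set E} {n : ℕ}
    (A : Algorithm D n) (F : Set (E → ℝ)) : ℝ≥0∞ :=
  ⨆ f ∈ F, ENNReal.ofReal |(∫ x in D, f x) - A.run f|

/-- The information complexity `n(ε, F)`: the minimal number of function values that is needed for
an error at most `ε` (and `∞` if no number of function values suffices). -/
noncomputable def infoComplexity {E : Type*} [MeasureSpace E] (D : Set E) (F : Set (E → ℝ))
    (ε : ℝ) : ℕ∞ :=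
  ⨅ (n : ℕ) (_ : ∃ A : Algorithm D n, A.error F ≤ ENNReal.ofReal ε), (n : ℕ∞)

/-- The curse of dimensionality for integration over `D d` of functions from the classes `F d`:
`n(ε, F d) ≥ c (1 + γ) ^ d` for all `ε ≤ ε₀` and infinitely many `d`. -/
def Curse (D : (d : ℕ) → Set (EuclideanSpace ℝ (Fin d)))
    (F : (d : ℕ) → Set (EuclideanSpace ℝ (Fin d) → ℝ)) : Prop :=
  ∃ c ε₀ γ : ℝ, 0 < c ∧ 0 < ε₀ ∧ 0 < γ ∧ ∀ ε : ℝ, 0 < ε → ε ≤ ε₀ →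
    ∃ᶠ d in atTop,
      ENNReal.ofReal (c * (1 + γ) ^ d) ≤ ((infoComplexity (D d) (F d) ε : ℕ∞) : ℝ≥0∞)

/-- The class of all `f ∈ C^k(D)` with `|f| ≤ 1` on `D` whose derivatives `f^(j)`, `j ≤ k`, viewed as
multilinear maps with the operator norm, are Lipschitz on `D` with constants `L j`, for an open set
`D`. Functions on `D` are represented by functions on the whole space; nothing outside of `D`
enters in the conditions. -/
def smoothClass {d : ℕ} (k : ℕ) (D : Set (EuclideanSpace ℝ (Fin d))) (L : ℕ → ℝ) :
    Set (EuclideanSpace ℝ (Fin d) → ℝ) :=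
  {f | ContDiffOn ℝ k f D ∧ (∀ x ∈ D, |f x| ≤ 1) ∧
    ∀ j ≤ k, ∀ x ∈ D, ∀ y ∈ D,
      ‖iteratedFDeriv ℝ j f x - iteratedFDeriv ℝ j f y‖ ≤ L j * ‖x - y‖}

/-- The open unit cube `(0, 1)^d`. -/
def unitCube (d : ℕ) : Set (EuclideanSpace ℝ (Fin d)) :=
  {x | ∀ i, x i ∈ Set.Ioo (0 : ℝ) 1}

/-- The radius of a set: the infimum over all centers `x` of `sup_{y ∈ D} ‖y - x‖`. -/
noncomputable def radius {E : Type*} [PseudoEMetricSpace E] (D : Set E) : ℝ≥0∞ :=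
  ⨅ x : E, ⨆ y ∈ D, edist y x

/-- Sequences of open sets of volume one, in dimensions `d ≥ 1`. -/
def OpenUnitVolume (D : (d : ℕ) → Set (EuclideanSpace ℝ (Fin d))) : Prop :=
  ∀ d, 1 ≤ d → IsOpen (D d) ∧ volume (D d) = 1

/-- Sequences of small radius: `limsup rad(D d) / √d < √(2 / (π e))`. -/
def SmallRadius (D : (d : ℕ) → Set (EuclideanSpace ℝ (Fin d))) : Prop :=
  limsup (fun d : ℕ => radius (D d) / ENNReal.ofReal √(d : ℝ)) atTop <
    ENNReal.ofReal √(2 / (Real.pi * Real.exp 1))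

/-- There are points `x d ∈ D d` and a constant `R` such that the volume of the part of `D d` that
has distance at least `R √d` from `x d` tends to zero. -/
def Concentrated (D : (d : ℕ) → Set (EuclideanSpace ℝ (Fin d))) : Prop :=
  ∃ (x : (d : ℕ) → EuclideanSpace ℝ (Fin d)) (R : ℝ), (∀ d, 1 ≤ d → x d ∈ D d) ∧
    Tendsto (fun d : ℕ => volume {y ∈ D d | R * √(d : ℝ) ≤ ‖y - x d‖}) atTop (𝓝 0)

end Integration

/-! Part (a) uses fooling functions. An algorithm receives the same data from `f` and `-f` if `f`
vanishes at the nodes chosen for the zero function, so adaption does not help. It suffices to find,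
for any n points of `D`, a function of the class that vanishes at them and has integral bounded
below. Take the squared distance to a neighbourhood of the convex hull of the points. Its gradient
is 2-Lipschitz (`exists_sqDist`), and `k` convolutions with a density of support radius `δ √d` make
it smooth (`IsMollifier.exists_smooth_sqDist`). A product density has directional derivatives with
`L¹` norms independent of the dimension (`exists_isMollifier`), so the derivatives of orders 1 to
`k` have dimension-free Lipschitz constants, while the function has Lipschitz constant of order `√d`
and size of order `d` on a domain of radius of order `√d`. Division by `d` gives exactly the scales
`1/√d` for `L 0` and `1/d` for the other `L j`.

The integral is large because most of `D` has distance of order `√d` from the hull. The condition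
`⟪x - p, x - z⟫ ≥ c d` is affine in `p`, so it passes from the points to their hull and there bounds
the distance of `x` from below. It fails for one `p` only on a set of volume at most `q ^ d` with `q
< 1`: by an exponential moment estimate for the cube, and for small radius because the exceptional
set lies in a ball of exponentially small volume. Hence a number of points of order `q⁻¹ ^ d` is
needed.

Part (b) integrates the Taylor polynomial of degree `j` at the center (`exists_cubature`). On the
ball of radius `R √d` the Taylor error is at most a constant times `L j d ^ ((j + 1) / 2)`, and the
rest of the domain has vanishing volume. Polynomials are recovered exactly from at most `(d + 1) ^
j` nodes. If these are contracted to the center by a factor `h`, the weights grow like `h ^ (-j)`,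
but `f` differs from its Taylor polynomial at the nodes by order `h ^ (j + 1)`. -/

namespace Integration

/-! ### Adaptive algorithms and information complexity -/

section Complexity

variable {E : Type*} {D : Set E} {n : ℕ}

/-- Adaptive choices depend only on earlier values, so agreement along the path of `g` keeps the two
paths together. -/
theorem Algorithm.values_congr (A : Algorithm D n) {f g : E → ℝ}
    (h : ∀ m < n, f (A.point m (A.values g m)) = g (A.point m (A.values g m))) :
    ∀ m ≤ n, A.values f m = A.values g m
  | 0, _ => rfl
  | m + 1, hm => by
    have ih := A.values_congr h m (by omega)
    simp only [Algorithm.values, ih, h m (by omega)]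

theorem Algorithm.values_apply {p : ℕ → E} (hp : ∀ m, m < n → p m ∈ D) (out : (Fin n → ℝ) → ℝ)
    (f : E → ℝ) (m : ℕ) (i : Fin m) :
    Algorithm.values (⟨fun m _ => p m, fun m hm _ => hp m hm, out⟩ : Algorithm D n) f m i =
      f (p i) := by
  induction m with
  | zero => exact i.elim0
  | succ m ih =>
    refine Fin.lastCases ?_ (fun i => ?_) i
    · simp [Algorithm.values]
    · simp [Algorithm.values, ih]

variable [MeasureSpace E]

theorem Algorithm.error_le_iff (A : Algorithm D n) (F : Set (E → ℝ)) {ε : ℝ} (hε : 0 ≤ ε) :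
    A.error F ≤ ENNReal.ofReal ε ↔ ∀ f ∈ F, |(∫ x in D, f x) - A.run f| ≤ ε := by
  simp only [Algorithm.error, iSup_le_iff, ENNReal.ofReal_le_ofReal_iff hε]

/-- An algorithm cannot have error `ε` if for all choices of the sample points some function
vanishes at these points, but not in the mean, and belongs to the class together with its
negative. -/
theorem Algorithm.lt_error (A : Algorithm D n) {F : Set (E → ℝ)} {ε : ℝ} (hε : 0 ≤ ε)
    (h : ∀ p : Fin n → E, (∀ i, p i ∈ D) →
      ∃ f, f ∈ F ∧ -f ∈ F ∧ (∀ i, f (p i) = 0) ∧ ε < ∫ x in D, f x) :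
    ENNReal.ofReal ε < A.error F := by
  by_contra! hA
  rw [A.error_le_iff F hε] at hA
  -- The nodes are those chosen for the zero function; `f` and `-f` reproduce its data.
  obtain ⟨f, hf, hf', h0, hint⟩ :=
    h (fun i => A.point i (A.values 0 i)) fun i => A.point_mem i i.2 _
  have hv : A.values f n = A.values 0 n :=
    A.values_congr (fun m hm => by simpa using h0 ⟨m, hm⟩) n le_rfl
  have hv' : A.values (-f) n = A.values 0 n :=
    A.values_congr (fun m hm => by simpa using h0 ⟨m, hm⟩) n le_rfl
  have h1 := hA f hf
  have h2 := hA (-f) hf'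
  simp only [Algorithm.run, hv, hv', Pi.neg_apply, integral_neg] at h1 h2
  rw [abs_le] at h1 h2
  linarith

theorem ofReal_le_infoComplexity {F : Set (E → ℝ)} {ε b : ℝ}
    (h : ∀ n : ℕ, (n : ℝ) < b → ∀ A : Algorithm D n, ENNReal.ofReal ε < A.error F) :
    ENNReal.ofReal b ≤ ((infoComplexity D F ε : ℕ∞) : ℝ≥0∞) := by
  have key : ∀ N : ℕ∞, infoComplexity D F ε = N → ENNReal.ofReal b ≤ (N : ℝ≥0∞) := by
    intro N hN
    induction N using ENat.recTopCoe with
    | top => simp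
    | coe N =>
      by_contra! hlt
      have hNb : (N : ℝ) < b := by
        rw [ENat.toENNReal_coe] at hlt
        rwa [← ENNReal.ofReal_natCast, ENNReal.ofReal_lt_ofReal_iff_of_nonneg (by positivity)]
          at hlt
      -- If the infimum `N` were below `b`, every successful `n` would exceed `N`, which forces the
      -- infimum up to `N + 1`.
      have : ((N + 1 : ℕ) : ℕ∞) ≤ infoComplexity D F ε := by
        refine le_iInf₂ fun n hn => ?_
        obtain ⟨A, hA⟩ := hn
        by_contra! hlt'
        have hnN : n ≤ N := by
          have : n < N + 1 := by exact_mod_cast hlt'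
          omega
        exact absurd hA (not_le.2 (h n (lt_of_le_of_lt (by exact_mod_cast hnN) hNb) A))
      rw [hN] at this
      have : N + 1 ≤ N := by exact_mod_cast this
      omega
  exact key _ rfl

theorem infoComplexity_le {F : Set (E → ℝ)} {ε : ℝ} (A : Algorithm D n)
    (hA : A.error F ≤ ENNReal.ofReal ε) : infoComplexity D F ε ≤ n :=
  iInf₂_le n ⟨A, hA⟩

/-- A cubature formula with `n` nodes bounds the information complexity. -/
theorem infoComplexity_le_of_cubature {F : Set (E → ℝ)} {ε : ℝ} (hε : 0 ≤ ε) (hD : D.Nonempty)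
    (p : Fin n → E) (hp : ∀ i, p i ∈ D) (w : Fin n → ℝ)
    (h : ∀ f ∈ F, |(∫ x in D, f x) - ∑ i, w i * f (p i)| ≤ ε) :
    infoComplexity D F ε ≤ n := by
  obtain ⟨x₀, hx₀⟩ := hD
  let q : ℕ → E := fun m => if hm : m < n then p ⟨m, hm⟩ else x₀
  have hq : ∀ m, m < n → q m ∈ D := fun m hm => by simp [q, hm, hp]
  let A : Algorithm D n := ⟨fun m _ => q m, fun m hm _ => hq m hm, fun y => ∑ i, w i * y i⟩
  refine infoComplexity_le A ((A.error_le_iff F hε).2 fun f hf => ?_)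
  have : A.run f = ∑ i, w i * f (p i) := by
    change ∑ i, w i * A.values f n i = _
    refine Finset.sum_congr rfl fun i _ => ?_
    rw [Algorithm.values_apply hq]
    simp [q]
  rw [this]
  exact h f hf

end Complexity

/-! ### Mollifiers with dimension-free derivative bounds -/

/-- A `C¹` probability density `φ` that is supported in the ball of radius `r`, and whose directional
derivatives have `L¹` norm at most `C`. -/
structure IsMollifier {E : Type*} [NormedAddCommGroup E] [NormedSpace ℝ E] [MeasureSpace E]
    (φ : E → ℝ) (r C : ℝ) : Prop where
  contDiff : ContDiff ℝ 1 φ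
  nonneg : ∀ t, 0 ≤ φ t
  norm_le : ∀ t, φ t ≠ 0 → ‖t‖ ≤ r
  integral_eq_one : ∫ t, φ t = 1
  integral_abs_fderiv_le : ∀ v, ∫ t, |fderiv ℝ φ t v| ≤ C * ‖v‖

/-- A smooth bump on the line, with normalized square. -/
theorem exists_bump {δ : ℝ} (hδ : 0 < δ) : ∃ b : ℝ → ℝ, ContDiff ℝ 1 b ∧ HasCompactSupport b ∧
    (∀ t, b t ≠ 0 → |t| ≤ δ) ∧ ∫ t, b t ^ 2 = 1 := by
  let B : ContDiffBump (0 : ℝ) := ⟨δ / 2, δ, by positivity, by linarith⟩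
  have hB : ContDiff ℝ 1 B := B.contDiff
  have hpos : 0 < ∫ t, B t ^ 2 := by
    refine Continuous.integral_pos_of_hasCompactSupport_nonneg_nonzero (x := 0)
      (hB.continuous.pow 2) ?_ (fun t => by positivity) ?_
    · exact B.hasCompactSupport.comp_left (g := fun x : ℝ => x ^ 2) (by simp)
    · have : B 0 = 1 := B.one_of_mem_closedBall (by simp [B]; positivity)
      simp [this]
  refine ⟨fun t => (√(∫ t, B t ^ 2))⁻¹ * B t, contDiff_const.mul hB,
    B.hasCompactSupport.mul_left, fun t ht => ?_, ?_⟩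
  · have h1 : B t ≠ 0 := fun h => ht (by simp [h])
    have h2 : t ∈ Function.support B := h1
    rw [B.support_eq] at h2
    simpa [B] using (Metric.mem_ball.1 h2).le
  · simp only [mul_pow, integral_const_mul, inv_pow, Real.sq_sqrt hpos.le]
    exact inv_mul_cancel₀ hpos.ne'

theorem integral_mul_deriv_self_eq_zero {b : ℝ → ℝ} (hb : ContDiff ℝ 1 b)
    (hs : HasCompactSupport b) : ∫ t, b t * deriv b t = 0 := by
  have hd : ∀ t, HasDerivAt (fun t => b t ^ 2 / 2) (b t * deriv b t) t := fun t => by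
    have := ((hb.differentiable one_ne_zero t).hasDerivAt.pow 2).div_const 2
    refine this.congr_deriv ?_
    simp
    ring
  have hc : Continuous (deriv b) := hb.continuous_deriv le_rfl
  refine integral_eq_zero_of_hasDerivAt_of_integrable hd ?_ ?_
  · exact (hb.continuous.mul hc).integrable_of_hasCompactSupport hs.mul_right
  · refine Continuous.integrable_of_hasCompactSupport (by have := hb.continuous; fun_prop) ?_
    exact hs.comp_left (g := fun x : ℝ => x ^ 2 / 2) (by simp)

section Product

variable {ι : Type*} [Fintype ι]

theorem integral_euclidean_prod (f : ι → ℝ → ℝ) :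
    ∫ x : EuclideanSpace ℝ ι, ∏ i, f i (x i) = ∏ i, ∫ t, f i t := by
  rw [← integral_fintype_prod_volume_eq_prod,
    ← (PiLp.volume_preserving_ofLp ι).integral_comp (MeasurableEquiv.measurableEmbedding
      (MeasurableEquiv.toLp 2 (ι → ℝ)).symm)]

theorem integrable_euclidean_prod {f : ι → ℝ → ℝ} (hf : ∀ i, Integrable (f i)) :
    Integrable fun x : EuclideanSpace ℝ ι => ∏ i, f i (x i) :=
  (PiLp.volume_preserving_ofLp ι).integrable_comp_of_integrable (Integrable.fintype_prod hf)

theorem norm_le_of_forall_abs_le {δ : ℝ} (hδ : 0 ≤ δ) {t : EuclideanSpace ℝ ι}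
    (h : ∀ i, |t i| ≤ δ) : ‖t‖ ≤ δ * √(Fintype.card ι) := by
  rw [EuclideanSpace.norm_eq, ← Real.sqrt_sq hδ, ← Real.sqrt_mul (sq_nonneg δ)]
  refine Real.sqrt_le_sqrt ?_
  calc ∑ i, ‖t i‖ ^ 2 ≤ ∑ _i : ι, δ ^ 2 :=
        Finset.sum_le_sum fun i _ => pow_le_pow_left₀ (norm_nonneg _) (h i) 2
    _ = δ ^ 2 * Fintype.card ι := by simp [mul_comm]

variable [DecidableEq ι]

/-- The factor in the direction `i` of a product bump is differentiated. -/
noncomputable def partialProd (b : ℝ → ℝ) (i : ι) (x : EuclideanSpace ℝ ι) : ℝ :=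
  ∏ j, (if j = i then deriv b else b) (x j)

theorem hasFDerivAt_prod_bump {b : ℝ → ℝ} (hb : ContDiff ℝ 1 b) (x : EuclideanSpace ℝ ι) :
    ∃ B' : EuclideanSpace ℝ ι →L[ℝ] ℝ,
      HasFDerivAt (fun x : EuclideanSpace ℝ ι => ∏ i, b (x i)) B' x ∧
      ∀ v, B' v = ∑ i, v i * partialProd b i x := by
  have h1 : ∀ i : ι, HasFDerivAt (fun x : EuclideanSpace ℝ ι => b (x i))
      (deriv b (x i) • (EuclideanSpace.proj i : EuclideanSpace ℝ ι →L[ℝ] ℝ)) x := fun i =>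
    (hb.differentiable one_ne_zero (x i)).hasDerivAt.comp_hasFDerivAt x
      (EuclideanSpace.proj i : EuclideanSpace ℝ ι →L[ℝ] ℝ).hasFDerivAt
  refine ⟨_, HasFDerivAt.finsetProd fun i _ => h1 i, fun v => ?_⟩
  rw [_root_.sum_apply]
  refine Finset.sum_congr rfl fun i _ => ?_
  have : partialProd b i x = deriv b (x i) * ∏ j ∈ Finset.univ.erase i, b (x j) := by
    rw [partialProd, ← Finset.mul_prod_erase _ _ (Finset.mem_univ i)]
    simp only [if_true]
    congr 1
    refine Finset.prod_congr rfl fun j hj => ?_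
    rw [if_neg (Finset.ne_of_mem_erase hj)]
  rw [this]
  simp
  ring

theorem integrable_partialProd_mul {b : ℝ → ℝ} (hb : ContDiff ℝ 1 b) (hs : HasCompactSupport b)
    (i l : ι) : Integrable fun x => partialProd b i x * partialProd b l x := by
  simp only [partialProd, ← Finset.prod_mul_distrib]
  have hc : Continuous (deriv b) := hb.continuous_deriv le_rfl
  refine integrable_euclidean_prod (f := fun j t =>
    (if j = i then deriv b else b) t * (if j = l then deriv b else b) t) fun j => ?_
  have h1 : ∀ k, Continuous (if j = k then deriv b else b) := fun k => by
    split_ifs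
    exacts [hc, hb.continuous]
  have h2 : HasCompactSupport (if j = i then deriv b else b) := by
    split_ifs
    exacts [hs.deriv, hs]
  exact ((h1 i).mul (h1 l)).integrable_of_hasCompactSupport h2.mul_right

/-- The integrals factorize. Distinct partial derivatives are orthogonal because `b * deriv b` has
integral zero; this keeps the dimension out of the constant. -/
theorem integral_partialProd_mul {b : ℝ → ℝ} (hb : ContDiff ℝ 1 b) (hs : HasCompactSupport b)
    (h1 : ∫ t, b t ^ 2 = 1) (i l : ι) :
    ∫ x, partialProd b i x * partialProd b l x = if i = l then ∫ t, deriv b t ^ 2 else 0 := by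
  simp only [partialProd, ← Finset.prod_mul_distrib]
  rw [integral_euclidean_prod (f := fun j t =>
    (if j = i then deriv b else b) t * (if j = l then deriv b else b) t)]
  split_ifs with h
  · subst h
    rw [← Finset.mul_prod_erase _ _ (Finset.mem_univ i), Finset.prod_eq_one, mul_one]
    · simp [sq]
    · intro j hj
      simpa [Finset.ne_of_mem_erase hj, sq] using h1
  · refine Finset.prod_eq_zero (Finset.mem_univ i) ?_
    simp only [if_true, if_neg h]
    rw [← integral_mul_deriv_self_eq_zero hb hs]
    exact integral_congr_ae (.of_forall fun t => mul_comm _ _)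

theorem integrable_sq_sum_partialProd {b : ℝ → ℝ} (hb : ContDiff ℝ 1 b)
    (hs : HasCompactSupport b) (v : EuclideanSpace ℝ ι) :
    Integrable fun x => (∑ i, v i * partialProd b i x) ^ 2 := by
  simp only [sq, Finset.sum_mul_sum]
  refine integrable_finsetSum _ fun i _ => integrable_finsetSum _ fun l _ => ?_
  refine ((integrable_partialProd_mul hb hs i l).const_mul (v i * v l)).congr
    (.of_forall fun x => ?_)
  ring

theorem integral_sq_sum_partialProd {b : ℝ → ℝ} (hb : ContDiff ℝ 1 b) (hs : HasCompactSupport b)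
    (h1 : ∫ t, b t ^ 2 = 1) (v : EuclideanSpace ℝ ι) :
    ∫ x, (∑ i, v i * partialProd b i x) ^ 2 = (∫ t, deriv b t ^ 2) * ‖v‖ ^ 2 := by
  have hterm : ∀ (i l : ι) x, v i * partialProd b i x * (v l * partialProd b l x) =
      v i * v l * (partialProd b i x * partialProd b l x) := fun i l x => by ring
  have hint : ∀ i l : ι, Integrable fun x : EuclideanSpace ℝ ι =>
      v i * v l * (partialProd b i x * partialProd b l x) :=
    fun i l => (integrable_partialProd_mul hb hs i l).const_mul _
  simp only [sq, Finset.sum_mul_sum, hterm]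
  rw [integral_finsetSum _ fun i _ => integrable_finsetSum _ fun l _ => hint i l]
  simp only [integral_finsetSum _ fun l _ => hint _ l, integral_const_mul,
    integral_partialProd_mul hb hs h1]
  simp only [← sq, EuclideanSpace.norm_sq_eq, Finset.mul_sum]
  refine Finset.sum_congr rfl fun i _ => ?_
  simp
  ring

/-- The density is a square `B ^ 2`, whose derivative `2 B ∂ᵥB` is controlled by the `L²` norms of
`B` and `∂ᵥB`. The second is a multiple of `‖v‖` by orthogonality. -/
theorem isMollifier_prod_bump {δ : ℝ} (hδ : 0 < δ) {b : ℝ → ℝ} (hb : ContDiff ℝ 1 b)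
    (hs : HasCompactSupport b) (hsupp : ∀ t, b t ≠ 0 → |t| ≤ δ) (h1 : ∫ t, b t ^ 2 = 1) :
    IsMollifier (fun x : EuclideanSpace ℝ ι => (∏ i, b (x i)) ^ 2) (δ * √(Fintype.card ι))
      (1 + ∫ t, deriv b t ^ 2) := by
  have hB : ContDiff ℝ 1 fun x : EuclideanSpace ℝ ι => ∏ i, b (x i) :=
    contDiff_prod fun i _ => hb.comp (EuclideanSpace.proj i : EuclideanSpace ℝ ι →L[ℝ] ℝ).contDiff
  have hsq : Integrable fun x : EuclideanSpace ℝ ι => (∏ i, b (x i)) ^ 2 := by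
    simp only [← Finset.prod_pow]
    refine integrable_euclidean_prod (f := fun _ t => b t ^ 2) fun i => ?_
    refine Continuous.integrable_of_hasCompactSupport (hb.continuous.pow 2) ?_
    exact hs.comp_left (g := fun x : ℝ => x ^ 2) (by simp)
  have hone : ∫ x : EuclideanSpace ℝ ι, (∏ i, b (x i)) ^ 2 = 1 := by
    simp only [← Finset.prod_pow]
    rw [integral_euclidean_prod (f := fun _ t => b t ^ 2)]
    simp [h1]
  refine ⟨hB.pow 2, fun t => by positivity, fun t ht => ?_, hone, fun v => ?_⟩
  · have h2 : ∀ i, |t i| ≤ δ := fun i => hsupp _ fun h0 => ht (by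
      rw [Finset.prod_eq_zero (Finset.mem_univ i) h0]; simp)
    exact norm_le_of_forall_abs_le hδ.le h2
  · rcases eq_or_ne v 0 with rfl | hv
    · simp
    have hv' : 0 < ‖v‖ := norm_pos_iff.2 hv
    have hfd : ∀ x, fderiv ℝ (fun x : EuclideanSpace ℝ ι => (∏ i, b (x i)) ^ 2) x v =
        2 * (∏ i, b (x i)) * ∑ i, v i * partialProd b i x := fun x => by
      obtain ⟨B', hB', hv⟩ := hasFDerivAt_prod_bump hb x
      rw [(hB'.pow 2).fderiv]
      simp [hv]
    -- The weights `‖v‖` and `‖v‖⁻¹` make both integrals linear in `‖v‖`.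
    have hle : ∀ x, |fderiv ℝ (fun x : EuclideanSpace ℝ ι => (∏ i, b (x i)) ^ 2) x v| ≤
        ‖v‖ * (∏ i, b (x i)) ^ 2 + ‖v‖⁻¹ * (∑ i, v i * partialProd b i x) ^ 2 := fun x => by
      rw [hfd]
      set p := ∏ i, b (x i)
      set q := ∑ i, v i * partialProd b i x
      have e1 : ‖v‖ * p ^ 2 + ‖v‖⁻¹ * q ^ 2 - 2 * p * q = ‖v‖⁻¹ * (‖v‖ * p - q) ^ 2 := by
        field_simp; ring
      have e2 : ‖v‖ * p ^ 2 + ‖v‖⁻¹ * q ^ 2 + 2 * p * q = ‖v‖⁻¹ * (‖v‖ * p + q) ^ 2 := by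
        field_simp; ring
      have g1 : 0 ≤ ‖v‖⁻¹ * (‖v‖ * p - q) ^ 2 := by positivity
      have g2 : 0 ≤ ‖v‖⁻¹ * (‖v‖ * p + q) ^ 2 := by positivity
      exact abs_le.2 ⟨by linarith, by linarith⟩
    have i1 := hsq.const_mul ‖v‖
    have i2 := (integrable_sq_sum_partialProd hb hs v).const_mul ‖v‖⁻¹
    refine (integral_mono_of_nonneg (.of_forall fun x => abs_nonneg _) (i1.add i2)
      (.of_forall hle)).trans_eq ?_
    simp only [Pi.add_apply]
    rw [integral_add i1 i2, integral_const_mul, integral_const_mul, hone,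
      integral_sq_sum_partialProd hb hs h1]
    field_simp

end Product

/-- In all dimensions `d` there are mollifiers that are supported in the ball of radius `δ √d` and
whose directional derivatives have `L¹` norms bounded independently of `d`. -/
theorem exists_isMollifier {δ : ℝ} (hδ : 0 < δ) : ∃ C : ℝ, 1 ≤ C ∧ ∀ d : ℕ,
    ∃ φ : EuclideanSpace ℝ (Fin d) → ℝ, IsMollifier φ (δ * √d) C := by
  obtain ⟨b, hb, hs, hsupp, h1⟩ := exists_bump hδ
  refine ⟨1 + ∫ t, deriv b t ^ 2, ?_, fun d => ?_⟩
  · have : 0 ≤ ∫ t, deriv b t ^ 2 := integral_nonneg fun t => by positivity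
    linarith
  · have := isMollifier_prod_bump (ι := Fin d) hδ hb hs hsupp h1
    rw [Fintype.card_fin] at this
    exact ⟨_, this⟩

/-! ### Smoothing by convolution -/

section Averaging

variable {E W : Type} [NormedAddCommGroup E] [NormedSpace ℝ E] [FiniteDimensional ℝ E]
  [MeasureSpace E] [BorelSpace E] [(volume : Measure E).IsAddHaarMeasure]
  [NormedAddCommGroup W] [NormedSpace ℝ W] [CompleteSpace W] {φ : E → ℝ} {r C : ℝ}

/-- The average of the translates of `g` with weight `φ`, that is, the convolution of `φ` and `g`. -/
noncomputable def avg {E W : Type} [NormedAddCommGroup E] [MeasureSpace E]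
    [NormedAddCommGroup W] [NormedSpace ℝ W] (φ : E → ℝ) (g : E → W) (x : E) : W :=
  ∫ t, φ t • g (x - t)

omit [BorelSpace E] [(volume : Measure E).IsAddHaarMeasure] in
theorem IsMollifier.hasCompactSupport (hφ : IsMollifier φ r C) : HasCompactSupport φ := by
  have : ProperSpace E := FiniteDimensional.proper_real E
  refine HasCompactSupport.intro (isCompact_closedBall (0 : E) r) fun t ht => ?_
  by_contra h
  exact ht (by simpa using hφ.norm_le t h)

omit [FiniteDimensional ℝ E] [BorelSpace E] [(volume : Measure E).IsAddHaarMeasure] in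
theorem IsMollifier.integrable (hφ : IsMollifier φ r C) : Integrable φ :=
  Integrable.of_integral_ne_zero (by rw [hφ.integral_eq_one]; exact one_ne_zero)

omit [CompleteSpace W] in
theorem IsMollifier.integrable_smul (hφ : IsMollifier φ r C) {g : E → W} (hg : Continuous g)
    (x : E) : Integrable fun t => φ t • g (x - t) := by
  have := hφ.contDiff.continuous
  exact Continuous.integrable_of_hasCompactSupport (by fun_prop) hφ.hasCompactSupport.smul_right

theorem IsMollifier.norm_avg_sub_le (hφ : IsMollifier φ r C) {g : E → W} (hg : Continuous g)
    {x : E} {c : W} {M : ℝ} (h : ∀ t, ‖t‖ ≤ r → ‖g (x - t) - c‖ ≤ M) : ‖avg φ g x - c‖ ≤ M := by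
  have h1 : avg φ g x - c = ∫ t, φ t • (g (x - t) - c) := by
    simp only [smul_sub]
    rw [integral_sub (hφ.integrable_smul hg x) (hφ.integrable.smul_const c), integral_smul_const,
      hφ.integral_eq_one, one_smul, avg]
  have h2 : ∫ t, φ t * M = M := by rw [integral_mul_const, hφ.integral_eq_one, one_mul]
  rw [h1, ← h2]
  refine norm_integral_le_of_norm_le (hφ.integrable.mul_const M) (.of_forall fun t => ?_)
  rw [norm_smul, Real.norm_of_nonneg (hφ.nonneg t)]
  rcases eq_or_ne (φ t) 0 with h0 | h0
  · simp [h0]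
  · exact mul_le_mul_of_nonneg_left (h t (hφ.norm_le t h0)) (hφ.nonneg t)

omit [CompleteSpace W] in
theorem IsMollifier.le_avg (hφ : IsMollifier φ r C) {g : E → ℝ} (hg : Continuous g)
    {x : E} {a : ℝ} (h : ∀ t, ‖t‖ ≤ r → a ≤ g (x - t)) : a ≤ avg φ g x := by
  have h2 : ∫ t, φ t • a = a := by simp [integral_mul_const, hφ.integral_eq_one]
  rw [← h2]
  refine integral_mono (hφ.integrable.smul_const a) (hφ.integrable_smul hg x) fun t => ?_
  rcases eq_or_ne (φ t) 0 with h0 | h0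
  · simp [h0]
  · exact mul_le_mul_of_nonneg_left (h t (hφ.norm_le t h0)) (hφ.nonneg t)

omit [CompleteSpace W] in
theorem IsMollifier.norm_avg_sub_avg_le (hφ : IsMollifier φ r C) {g : E → W} (hg : Continuous g)
    {M : ℝ} (h : ∀ x y, ‖g x - g y‖ ≤ M * ‖x - y‖) (x y : E) :
    ‖avg φ g x - avg φ g y‖ ≤ M * ‖x - y‖ := by
  have h1 : avg φ g x - avg φ g y = ∫ t, φ t • (g (x - t) - g (y - t)) := by
    simp only [smul_sub]
    rw [integral_sub (hφ.integrable_smul hg x) (hφ.integrable_smul hg y), avg, avg]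
  have h2 : ∫ t, φ t * (M * ‖x - y‖) = M * ‖x - y‖ := by
    rw [integral_mul_const, hφ.integral_eq_one, one_mul]
  rw [h1, ← h2]
  refine norm_integral_le_of_norm_le (hφ.integrable.mul_const _) (.of_forall fun t => ?_)
  rw [norm_smul, Real.norm_of_nonneg (hφ.nonneg t)]
  exact mul_le_mul_of_nonneg_left (by simpa using h (x - t) (y - t)) (hφ.nonneg t)

omit [CompleteSpace W] in
theorem IsMollifier.hasFDerivAt_avg (hφ : IsMollifier φ r C) {g : E → W} (hg : ContDiff ℝ 1 g)
    (x : E) : HasFDerivAt (avg φ g) (avg φ (fderiv ℝ g) x) x := by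
  have : ProperSpace E := FiniteDimensional.proper_real E
  have hc : Continuous (fderiv ℝ g) := hg.continuous_fderiv one_ne_zero
  obtain ⟨K, hK⟩ := (isCompact_closedBall x (1 + r)).exists_bound_of_continuousOn
    hc.continuousOn
  refine hasFDerivAt_integral_of_dominated_of_fderiv_le (Metric.ball_mem_nhds x one_pos)
    (F := fun x t => φ t • g (x - t)) (F' := fun x t => φ t • fderiv ℝ g (x - t))
    (bound := fun t => φ t * K)
    (.of_forall fun y => (hφ.integrable_smul hg.continuous y).aestronglyMeasurable)
    (hφ.integrable_smul hg.continuous x) (hφ.integrable_smul hc x).aestronglyMeasurable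
    (.of_forall fun t y hy => ?_) (hφ.integrable.mul_const K) (.of_forall fun t y _ => ?_)
  · rw [norm_smul, Real.norm_of_nonneg (hφ.nonneg t)]
    rcases eq_or_ne (φ t) 0 with h0 | h0
    · simp [h0]
    · refine mul_le_mul_of_nonneg_left (hK _ ?_) (hφ.nonneg t)
      rw [mem_closedBall_iff_norm, sub_right_comm]
      exact (norm_sub_le _ _).trans (add_le_add (mem_ball_iff_norm.1 hy).le (hφ.norm_le t h0))
  · have := (hg.differentiable one_ne_zero (y - t)).hasFDerivAt.comp y
      ((hasFDerivAt_id y).sub_const t)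
    exact this.const_smul (φ t)

omit [CompleteSpace W] in
theorem IsMollifier.differentiable_avg (hφ : IsMollifier φ r C) {g : E → W}
    (hg : Continuous g) : Differentiable ℝ (avg φ g) := fun x =>
  (hφ.hasCompactSupport.hasFDerivAt_convolution_left (ContinuousLinearMap.lsmul ℝ ℝ)
    hφ.contDiff hg.locallyIntegrable x).differentiableAt

omit [CompleteSpace W] in
-- The derivative falls on `φ`, so a Lipschitz `g` gains one order of smoothness at the price of the
-- factor `C`.
theorem IsMollifier.norm_fderiv_avg_sub_le (hφ : IsMollifier φ r C) {g : E → W}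
    (hg : Continuous g) {M : ℝ} (h : ∀ x y, ‖g x - g y‖ ≤ M * ‖x - y‖) (hC : 0 ≤ M * C)
    (x y : E) :
    ‖fderiv ℝ (avg φ g) x - fderiv ℝ (avg φ g) y‖ ≤ M * C * ‖x - y‖ := by
  have hcd : Continuous (fderiv ℝ φ) := hφ.contDiff.continuous_fderiv one_ne_zero
  have hint : ∀ x, Integrable fun t => ((ContinuousLinearMap.lsmul ℝ ℝ).precompL E)
      (fderiv ℝ φ t) (g (x - t)) := fun x =>
    (hφ.hasCompactSupport.fderiv ℝ).convolutionExists_left _ hcd hg.locallyIntegrable x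
  have hD : ∀ x v, fderiv ℝ (avg φ g) x v = ∫ t, fderiv ℝ φ t v • g (x - t) := fun x v => by
    have := hφ.hasCompactSupport.hasFDerivAt_convolution_left (ContinuousLinearMap.lsmul ℝ ℝ)
      hφ.contDiff (hg.locallyIntegrable (μ := volume)) x
    change HasFDerivAt (avg φ g) _ _ at this
    rw [this.fderiv]
    change (∫ t, ((ContinuousLinearMap.lsmul ℝ ℝ).precompL E) (fderiv ℝ φ t) (g (x - t))) v = _
    rw [ContinuousLinearMap.integral_apply (hint x)]
    rfl
  have hDint : ∀ x v, Integrable fun t => fderiv ℝ φ t v • g (x - t) := fun x v => by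
    refine Continuous.integrable_of_hasCompactSupport (by fun_prop) ?_
    exact ((hφ.hasCompactSupport.fderiv ℝ).comp_left (g := fun A : E →L[ℝ] ℝ => A v)
      (by simp)).smul_right
  refine ContinuousLinearMap.opNorm_le_bound _ (by positivity) fun v => ?_
  have hab : Integrable fun t => |fderiv ℝ φ t v| :=
    (Continuous.integrable_of_hasCompactSupport (by fun_prop)
      ((hφ.hasCompactSupport.fderiv ℝ).comp_left (g := fun A : E →L[ℝ] ℝ => A v) (by simp))).abs
  rw [_root_.sub_apply, hD, hD, ← integral_sub (hDint x v) (hDint y v)]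
  calc ‖∫ t, (fderiv ℝ φ t v • g (x - t) - fderiv ℝ φ t v • g (y - t))‖
      ≤ ∫ t, |fderiv ℝ φ t v| * (M * ‖x - y‖) := by
        refine norm_integral_le_of_norm_le (hab.mul_const _) (.of_forall fun t => ?_)
        rw [← smul_sub, norm_smul, Real.norm_eq_abs]
        exact mul_le_mul_of_nonneg_left (by simpa using h (x - t) (y - t)) (abs_nonneg _)
    _ = (∫ t, |fderiv ℝ φ t v|) * (M * ‖x - y‖) := integral_mul_const _ _
    _ ≤ C * ‖v‖ * (M * ‖x - y‖) := by
        rcases eq_or_ne x y with rfl | hxy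
        · simp
        · refine mul_le_mul_of_nonneg_right (hφ.integral_abs_fderiv_le v) ?_
          exact (norm_nonneg _).trans (h x y)
    _ = M * C * ‖x - y‖ * ‖v‖ := by ring

/-- The derivatives of order `i ≤ n` exist and have Lipschitz constants `M * C ^ i`. -/
structure SmoothLip (n : ℕ) (M C : ℝ) (g : E → W) : Prop where
  contDiff : ContDiff ℝ n g
  lip : ∀ i ≤ n, ∀ x y,
    ‖iteratedFDeriv ℝ i g x - iteratedFDeriv ℝ i g y‖ ≤ M * C ^ i * ‖x - y‖

theorem IsMollifier.iteratedFDeriv_avg (hφ : IsMollifier φ r C) {n : ℕ} {g : E → W}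
    (hg : ContDiff ℝ n g) : ∀ i ≤ n, iteratedFDeriv ℝ i (avg φ g) = avg φ (iteratedFDeriv ℝ i g)
  | 0, _ => by
    ext1 x
    simp only [iteratedFDeriv_zero_eq_comp, avg, Function.comp_apply]
    exact ((continuousMultilinearCurryFin0 ℝ E W).symm.toContinuousLinearEquiv.toContinuousLinearMap
      |>.integral_comp_comm (hφ.integrable_smul hg.continuous x)).symm.trans (by simp)
  | i + 1, hi => by
    have ih := hφ.iteratedFDeriv_avg hg i (by omega)
    have h1 : ContDiff ℝ 1 (iteratedFDeriv ℝ i g) :=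
      hg.iteratedFDeriv_right (by exact_mod_cast (by omega : 1 + i ≤ n))
    ext1 x
    rw [iteratedFDeriv_succ_eq_comp_left, iteratedFDeriv_succ_eq_comp_left, Function.comp_apply,
      ih, (hφ.hasFDerivAt_avg h1 x).fderiv]
    simp only [avg, Function.comp_apply]
    exact ((continuousMultilinearCurryLeftEquiv ℝ (fun _ : Fin (i + 1) => E)
      W).symm.toContinuousLinearEquiv.toContinuousLinearMap
      |>.integral_comp_comm (hφ.integrable_smul (h1.continuous_fderiv one_ne_zero) x)).symm.trans
        (integral_congr_ae (.of_forall fun t => ContinuousLinearMap.map_smul _ _ _))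

omit [FiniteDimensional ℝ E] [MeasureSpace E] [BorelSpace E]
  [(volume : Measure E).IsAddHaarMeasure] [CompleteSpace W] in
theorem norm_iteratedFDeriv_succ_sub (n : ℕ) (g : E → W) (x y : E) :
    ‖iteratedFDeriv ℝ (n + 1) g x - iteratedFDeriv ℝ (n + 1) g y‖ =
      ‖fderiv ℝ (iteratedFDeriv ℝ n g) x - fderiv ℝ (iteratedFDeriv ℝ n g) y‖ := by
  rw [← dist_eq_norm]
  exact ((continuousMultilinearCurryLeftEquiv ℝ (fun _ : Fin (n + 1) => E) W).symm.dist_map _ _).trans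
    (dist_eq_norm _ _)

/-- Up to order `n` averaging commutes with differentiation and preserves the Lipschitz constants;
the new order `n + 1` comes from differentiating `φ`. -/
theorem SmoothLip.avg (hφ : IsMollifier φ r C) {n : ℕ} {M : ℝ} (hM : 0 ≤ M) (hC : 0 ≤ C)
    {g : E → W} (hg : SmoothLip n M C g) : SmoothLip (n + 1) M C (avg φ g) := by
  have hI := hφ.iteratedFDeriv_avg hg.contDiff
  have hc : ∀ i ≤ n, Continuous (iteratedFDeriv ℝ i g) := fun i hi =>
    hg.contDiff.continuous_iteratedFDeriv (by exact_mod_cast hi)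
  have hlip : ∀ i ≤ n + 1, ∀ x y,
      ‖iteratedFDeriv ℝ i (Integration.avg φ g) x - iteratedFDeriv ℝ i (Integration.avg φ g) y‖ ≤
        M * C ^ i * ‖x - y‖ := by
    intro i hi x y
    rcases Nat.lt_or_ge n i with h | h
    · obtain rfl : i = n + 1 := by omega
      rw [norm_iteratedFDeriv_succ_sub, hI n le_rfl, pow_succ, ← mul_assoc]
      exact hφ.norm_fderiv_avg_sub_le (hc n le_rfl) (hg.lip n le_rfl) (by positivity) x y
    · rw [hI i h]
      exact hφ.norm_avg_sub_avg_le (hc i h) (hg.lip i h) x y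
  refine ⟨contDiff_nat_iff_continuous_differentiable.2 ⟨fun i hi => ?_, fun i hi => ?_⟩, hlip⟩
  · exact (LipschitzWith.of_dist_le_mul (K := (M * C ^ i).toNNReal) fun x y => by
      rw [dist_eq_norm, dist_eq_norm, Real.coe_toNNReal _ (by positivity)]
      exact hlip i hi x y).continuous
  · rw [hI i (by omega)]
    exact hφ.differentiable_avg (hc i (by omega))

end Averaging

/-! ### The squared distance to a convex set -/

section SqDist

variable {E : Type*} [NormedAddCommGroup E] [InnerProductSpace ℝ E] [CompleteSpace E]

open scoped InnerProductSpace

/-- The squared distance to a closed convex set has a Lipschitz continuous gradient. -/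
theorem exists_sqDist {S : Set E} (hne : S.Nonempty) (hcl : IsClosed S) (hconv : Convex ℝ S) :
    ∃ (F : E → ℝ) (G : E → E), (∀ x y, ‖G x - G y‖ ≤ ‖x - y‖) ∧
      (∀ x, HasFDerivAt F ((2 : ℝ) • innerSL ℝ (G x)) x) ∧ (∀ x ∈ S, F x = 0) ∧
      ∀ x, ∃ z ∈ S, F x = ‖x - z‖ ^ 2 := by
  have hP : ∀ x : E, ∃ z ∈ S, ∀ w ∈ S, ⟪x - z, w - z⟫_ℝ ≤ 0 := fun x => by
    obtain ⟨z, hz, h⟩ := exists_norm_eq_iInf_of_complete_convex hne hcl.isComplete hconv x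
    exact ⟨z, hz, (norm_eq_iInf_iff_real_inner_le_zero hconv hz).1 h⟩
  choose P hPS hPi using hP
  have hmin : ∀ x, ∀ w ∈ S, ‖x - P x‖ ^ 2 ≤ ‖x - w‖ ^ 2 := fun x w hw => by
    have h1 := hPi x w hw
    have h2 : x - w = (x - P x) - (w - P x) := by abel
    rw [h2, norm_sub_sq_real (x - P x)]
    nlinarith [sq_nonneg ‖w - P x‖]
  -- The variational inequalities at `P x` and `P y` give `⟪u - v, w⟫ ≥ 0`, so the decomposition `x
  -- - y = (u - v) + w` can only lengthen `u - v`.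
  have hG : ∀ x y, ‖(x - P x) - (y - P y)‖ ≤ ‖x - y‖ := fun x y => by
    have h1 := hPi x (P y) (hPS y)
    have h2 := hPi y (P x) (hPS x)
    set u := x - P x
    set v := y - P y
    set w := P x - P y with hw
    have e1 : P y - P x = -w := by rw [hw]; abel
    have e2 : x - y = (u - v) + w := by simp only [u, v, w]; abel
    rw [e1, inner_neg_right] at h1
    have h3 : ‖x - y‖ ^ 2 = ‖u - v‖ ^ 2 + 2 * ⟪u - v, w⟫_ℝ + ‖w‖ ^ 2 := by
      rw [e2, norm_add_sq_real]
    rw [inner_sub_left] at h3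
    refine le_of_sq_le_sq ?_ (norm_nonneg _)
    nlinarith [sq_nonneg ‖w‖]
  -- `P x` is a competitor for `P y`. Used in both directions and combined with `hG`, this bounds
  -- the first-order remainder by `3 ‖y - x‖ ^ 2`.
  have hup : ∀ x y, ‖y - P y‖ ^ 2 ≤
      ‖x - P x‖ ^ 2 + 2 * ⟪x - P x, y - x⟫_ℝ + ‖y - x‖ ^ 2 := fun x y => by
    have h := hmin y (P x) (hPS x)
    have e : y - P x = (x - P x) + (y - x) := by abel
    rwa [e, norm_add_sq_real] at h
  refine ⟨fun x => ‖x - P x‖ ^ 2, fun x => x - P x, hG, fun x => ?_, fun x hx => ?_,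
    fun x => ⟨P x, hPS x, rfl⟩⟩
  · refine .of_isLittleO ?_
    refine Asymptotics.IsBigO.trans_isLittleO (g := fun y => ‖y - x‖ ^ 2) ?_ ?_
    · refine Asymptotics.IsBigO.of_bound 3 (.of_forall fun y => ?_)
      have h1 := hup x y
      have h2 := hup y x
      have h3 : |⟪(y - P y) - (x - P x), x - y⟫_ℝ| ≤ ‖y - x‖ * ‖y - x‖ := by
        refine (abs_real_inner_le_norm _ _).trans ?_
        rw [norm_sub_rev x y]
        exact mul_le_mul_of_nonneg_right (hG y x) (norm_nonneg _)
      rw [inner_sub_left] at h3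
      have e1 : ⟪x - P x, x - y⟫_ℝ = -⟪x - P x, y - x⟫_ℝ := by
        rw [← inner_neg_right, neg_sub]
      rw [e1] at h3
      rw [norm_sub_rev x y] at h2
      have h4 := abs_le.1 h3
      simp only [_root_.smul_apply, innerSL_apply_apply, smul_eq_mul, Real.norm_eq_abs,
        abs_pow, abs_norm]
      rw [abs_le]
      constructor <;> nlinarith [sq_nonneg ‖y - x‖]
    · exact Asymptotics.isLittleO_pow_sub_sub x one_lt_two
  · have h := hmin x x hx
    simp only [sub_self, norm_zero] at h
    exact le_antisymm (by simpa using h) (by positivity)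

end SqDist

/-! ### Smoothed squared distances that vanish at given points -/

section Flat

variable {E : Type} [NormedAddCommGroup E] [InnerProductSpace ℝ E] [FiniteDimensional ℝ E]
  [MeasureSpace E] [BorelSpace E] [(volume : Measure E).IsAddHaarMeasure] {φ : E → ℝ} {r C : ℝ}

theorem smoothLip_iterate_avg {W : Type} [NormedAddCommGroup W] [NormedSpace ℝ W] [CompleteSpace W]
    (hφ : IsMollifier φ r C) (hC : 0 ≤ C) {M : ℝ} (hM : 0 ≤ M) {g : E → W}
    (hg : ∀ x y, ‖g x - g y‖ ≤ M * ‖x - y‖) : ∀ m, SmoothLip m M C ((avg φ)^[m] g)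
  | 0 => by
    have hc : Continuous g := (LipschitzWith.of_dist_le_mul (K := M.toNNReal) fun x y => by
      rw [dist_eq_norm, dist_eq_norm, Real.coe_toNNReal _ hM]
      exact hg x y).continuous
    refine ⟨contDiff_zero.2 hc, fun i hi x y => ?_⟩
    obtain rfl : i = 0 := by omega
    simp only [Function.iterate_zero, id, iteratedFDeriv_zero_eq_comp, Function.comp_apply,
      ← map_sub, LinearIsometryEquiv.norm_map, pow_zero, mul_one]
    exact hg x y
  | m + 1 => by
    rw [Function.iterate_succ_apply']
    exact (smoothLip_iterate_avg hφ hC hM hg m).avg hφ hM hC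

/-- The squared distance is in general not globally Lipschitz, but its gradient is. Commuting the
averages with the derivative allows the smoothing bounds to be applied to the gradient. -/
theorem hasFDerivAt_iterate_avg (hφ : IsMollifier φ r C) (hC : 0 ≤ C) {M : ℝ} (hM : 0 ≤ M)
    {f : E → ℝ} {f' : E → E →L[ℝ] ℝ} (hf : ∀ x, HasFDerivAt f (f' x) x)
    (hlip : ∀ x y, ‖f' x - f' y‖ ≤ M * ‖x - y‖) :
    ∀ m x, HasFDerivAt ((avg φ)^[m] f) ((avg φ)^[m] f' x) x
  | 0, x => hf x
  | m + 1, x => by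
    have ih := hasFDerivAt_iterate_avg hφ hC hM hf hlip m
    have hs := (smoothLip_iterate_avg hφ hC hM hlip m).contDiff.continuous
    have h1 : ContDiff ℝ 1 ((avg φ)^[m] f) := by
      refine contDiff_one_iff_hasFDerivAt.2 ⟨_, hs, ih⟩
    have h2 : fderiv ℝ ((avg φ)^[m] f) = (avg φ)^[m] f' := funext fun x => (ih x).fderiv
    rw [Function.iterate_succ_apply', Function.iterate_succ_apply', ← h2]
    exact hφ.hasFDerivAt_avg h1 x

/-- Each average looks at most `r` further away. -/
theorem iterate_avg_eq_zero (hφ : IsMollifier φ r C) {f : E → ℝ}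
    (hc : ∀ m, Continuous ((avg φ)^[m] f)) :
    ∀ (m : ℕ) (x : E), (∀ y, ‖x - y‖ ≤ m * r → f y = 0) → (avg φ)^[m] f x = 0
  | 0, x, h => h x (by simp)
  | m + 1, x, h => by
    rw [Function.iterate_succ_apply', ← norm_le_zero_iff, ← sub_zero (avg φ _ x)]
    refine hφ.norm_avg_sub_le (hc m) fun t ht => ?_
    rw [iterate_avg_eq_zero hφ hc m (x - t) fun y hy => h y ?_]
    · simp
    · have : x - y = (x - t - y) + t := by abel
      rw [this]
      push_cast
      linarith [norm_add_le (x - t - y) t]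

theorem le_iterate_avg (hφ : IsMollifier φ r C) {f : E → ℝ} {a : ℝ}
    (hc : ∀ m, Continuous ((avg φ)^[m] f)) :
    ∀ (m : ℕ) (x : E), (∀ y, ‖x - y‖ ≤ m * r → a ≤ f y) → a ≤ (avg φ)^[m] f x
  | 0, x, h => h x (by simp)
  | m + 1, x, h => by
    rw [Function.iterate_succ_apply']
    refine hφ.le_avg (hc m) fun t ht => le_iterate_avg hφ hc m (x - t) fun y hy => h y ?_
    have : x - y = (x - t - y) + t := by abel
    rw [this]
    push_cast
    linarith [norm_add_le (x - t - y) t]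

/-- A smoothed squared distance to the convex hull of finitely many points, which vanishes at these
points. -/
theorem IsMollifier.exists_smooth_sqDist (hφ : IsMollifier φ r C) (hr : 0 ≤ r) (hC : 1 ≤ C)
    (k : ℕ) {P : Set E} (hfin : P.Finite) (hP : P.Nonempty) :
    ∃ F : E → ℝ, ContDiff ℝ (k + 1) F ∧ (∀ p ∈ P, F p = 0) ∧ (∀ x, 0 ≤ F x) ∧
      (∀ x y, ‖fderiv ℝ F x - fderiv ℝ F y‖ ≤ 2 * ‖x - y‖) ∧
      (∀ i, 1 ≤ i → i ≤ k → ∀ x y,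
        ‖iteratedFDeriv ℝ i F x - iteratedFDeriv ℝ i F y‖ ≤ 2 * C ^ k * ‖x - y‖) ∧
      ∀ x a, 0 ≤ a → (∀ z ∈ convexHull ℝ P, a + 2 * k * r ≤ ‖x - z‖) → a ^ 2 ≤ F x := by
  have hK : IsCompact (convexHull ℝ P) := hfin.isCompact_convexHull ℝ
  have hkr : 0 ≤ k * r := by positivity
  -- Thickening by `k * r` compensates for the reach of `k` averages, so the zeros at `P` survive.
  set S := Metric.cthickening (k * r) (convexHull ℝ P) with hS
  have hPS : convexHull ℝ P ⊆ S := Metric.self_subset_cthickening _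
  obtain ⟨f, G, hG, hfd, hf0, hfS⟩ := exists_sqDist (S := S)
    ((hP.mono (subset_convexHull ℝ P)).mono hPS) Metric.isClosed_cthickening
    ((convex_convexHull ℝ P).cthickening _)
  set f' : E → E →L[ℝ] ℝ := fun x => (2 : ℝ) • innerSL ℝ (G x)
  have hlip : ∀ x y, ‖f' x - f' y‖ ≤ 2 * ‖x - y‖ := fun x y => by
    change ‖(2 : ℝ) • innerSL ℝ (G x) - (2 : ℝ) • innerSL ℝ (G y)‖ ≤ _
    rw [← smul_sub, ← map_sub, norm_smul, innerSL_apply_norm, Real.norm_ofNat]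
    exact mul_le_mul_of_nonneg_left (hG x y) zero_le_two
  have hC0 : 0 ≤ C := zero_le_one.trans hC
  have hFd := hasFDerivAt_iterate_avg hφ hC0 zero_le_two hfd hlip
  have hFc : ∀ m, Continuous ((avg φ)^[m] f) := fun m =>
    (show Differentiable ℝ _ from fun x => (hFd m x).differentiableAt).continuous
  have hH := smoothLip_iterate_avg hφ hC0 zero_le_two hlip k
  have hfun : fderiv ℝ ((avg φ)^[k] f) = (avg φ)^[k] f' := funext fun x => (hFd k x).fderiv
  refine ⟨(avg φ)^[k] f, ?_, fun p hp => ?_, fun x => ?_, fun x y => ?_, fun i hi hik x y => ?_,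
    fun x a ha h => ?_⟩
  · exact contDiff_succ_iff_hasFDerivAt.2 ⟨_, hH.contDiff, hFd k⟩
  · refine iterate_avg_eq_zero hφ hFc k p fun y hy => hf0 y ?_
    refine Metric.mem_cthickening_of_dist_le y p _ _ (subset_convexHull ℝ P hp) ?_
    rwa [dist_comm, dist_eq_norm]
  · refine le_iterate_avg hφ hFc k x fun y _ => ?_
    obtain ⟨z, -, hz⟩ := hfS y
    rw [hz]
    positivity
  · have := hH.lip 0 (Nat.zero_le k) x y
    simp only [iteratedFDeriv_zero_eq_comp, Function.comp_apply, ← map_sub,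
      LinearIsometryEquiv.norm_map, pow_zero, mul_one] at this
    rwa [hfun]
  · obtain ⟨i, rfl⟩ := Nat.exists_eq_add_of_le' hi
    have h1 := hH.lip i (by omega) x y
    rw [iteratedFDeriv_succ_eq_comp_right, iteratedFDeriv_succ_eq_comp_right, Function.comp_apply,
      Function.comp_apply, ← dist_eq_norm, LinearIsometryEquiv.dist_map, hfun, dist_eq_norm]
    refine h1.trans (mul_le_mul_of_nonneg_right ?_ (norm_nonneg _))
    exact mul_le_mul_of_nonneg_left (pow_le_pow_right₀ hC (by omega)) zero_le_two
  -- Of the loss `2 * k * r`, one half is due to the averages and one half to the thickening.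
  · refine le_iterate_avg hφ hFc k x fun y hy => ?_
    obtain ⟨z, hz, hfz⟩ := hfS y
    rw [hS, hK.cthickening_eq_biUnion_closedBall hkr] at hz
    simp only [Set.mem_iUnion, mem_closedBall_iff_norm, exists_prop] at hz
    obtain ⟨w, hw, hzw⟩ := hz
    have h1 := h w hw
    have h2 : x - w = (x - y) + ((y - z) + (z - w)) := by abel
    have h3 := norm_add_le (x - y) ((y - z) + (z - w))
    have h4 := norm_add_le (y - z) (z - w)
    rw [h2] at h1
    rw [hfz]
    exact pow_le_pow_left₀ ha (by linarith) 2

end Flat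

/-! ### Exponentially small exceptional sets -/

open scoped InnerProductSpace in
/-- An open set of volume one that lies in a ball of radius `R √d`, with a center `z` such that, for
all points `p` of the set, the part of the set that is not separated from `p` by a
hyperplane orthogonal to the line through `z` has volume at most `q ^ d`. -/
def Spread {d : ℕ} (D : Set (EuclideanSpace ℝ (Fin d))) (R c q : ℝ) : Prop :=
  IsOpen D ∧ volume D = 1 ∧ ∃ z, (∀ x ∈ D, ‖x - z‖ ≤ R * √d) ∧
    ∀ p ∈ D, volume {x ∈ D | ⟪x - p, x - z⟫_ℝ < c * d} ≤ ENNReal.ofReal (q ^ d)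

theorem measure_le_ofReal_integral {α : Type*} [MeasurableSpace α] {μ : Measure α} {g : α → ℝ}
    (hg : Integrable g μ) (h0 : ∀ x, 0 ≤ g x) {s : Set α} (hs : ∀ x ∈ s, 1 ≤ g x) :
    μ s ≤ ENNReal.ofReal (∫ x, g x ∂μ) := by
  rw [ofReal_integral_eq_lintegral_ofReal hg (.of_forall h0)]
  have h := mul_meas_ge_le_lintegral₀ (μ := μ) (hg.aestronglyMeasurable.aemeasurable.ennreal_ofReal) 1
  rw [one_mul] at h
  refine (measure_mono fun x hx => ?_).trans h
  simpa using hs x hx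

section Cube

variable {d : ℕ}

theorem unitCube_eq_preimage : unitCube d =
    (WithLp.ofLp : EuclideanSpace ℝ (Fin d) → Fin d → ℝ) ⁻¹' Set.univ.pi fun _ => Set.Ioo 0 1 := by
  ext x
  simp [unitCube]

theorem isOpen_unitCube : IsOpen (unitCube d) := by
  rw [unitCube_eq_preimage]
  exact (isOpen_set_pi Set.finite_univ fun _ _ => isOpen_Ioo).preimage
    (PiLp.continuous_ofLp 2 _)

theorem volume_unitCube : volume (unitCube d) = 1 := by
  rw [unitCube_eq_preimage, (PiLp.volume_preserving_ofLp (Fin d)).measure_preimage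
    (MeasurableSet.univ_pi fun _ => measurableSet_Ioo).nullMeasurableSet]
  simp [volume_pi_pi]

/-- The mean of `(t - a) * (t - 1 / 2)` over the interval is `1 / 12` for every `a`. With `exp s ≤ 1
+ s + s ^ 2` the integral is at most `1 - 1 / 72 + 1 / 144`. -/
theorem integral_exp_parabola_le {a : ℝ} (ha : a ∈ Set.Ioo (0 : ℝ) 1) :
    ∫ t in Set.Ioo (0 : ℝ) 1, Real.exp (-(1 / 6) * ((t - a) * (t - 1 / 2))) ≤
      Real.exp (-(1 / 144)) := by
  have hle : ∀ t ∈ Set.Ioo (0 : ℝ) 1, Real.exp (-(1 / 6) * ((t - a) * (t - 1 / 2))) ≤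
      1 - 1 / 6 * ((t - a) * (t - 1 / 2)) + 1 / 144 := fun t ht => by
    set y := (t - a) * (t - 1 / 2)
    have hy : |y| ≤ 1 / 2 := by
      rw [abs_mul, show (1 / 2 : ℝ) = 1 * (1 / 2) by norm_num]
      exact mul_le_mul (abs_le.2 ⟨by linarith [ha.2, ht.1], by linarith [ha.1, ht.2]⟩)
        (abs_le.2 ⟨by linarith [ht.1], by linarith [ht.2]⟩) (abs_nonneg _) zero_le_one
    have hy2 := abs_le.1 hy
    have h1 := Real.abs_exp_sub_one_sub_id_le (x := -(1 / 6) * y)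
      (abs_le.2 ⟨by linarith, by linarith⟩)
    have h2 := (abs_le.1 h1).2
    nlinarith [sq_nonneg y]
  have hi : ∀ f : ℝ → ℝ, Continuous f → IntegrableOn f (Set.Ioo 0 1) := fun f hf =>
    (hf.integrableOn_Icc).mono_set Set.Ioo_subset_Icc_self
  refine (setIntegral_mono_on (hi _ (by fun_prop)) (hi _ (by fun_prop)) measurableSet_Ioo
    hle).trans ?_
  rw [← integral_Ioc_eq_integral_Ioo, ← intervalIntegral.integral_of_le zero_le_one]
  have hF : ∀ t : ℝ, HasDerivAt
      (fun t => t - 1 / 6 * (t ^ 3 / 3 - (a + 1 / 2) * t ^ 2 / 2 + a / 2 * t) + 1 / 144 * t)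
      (1 - 1 / 6 * ((t - a) * (t - 1 / 2)) + 1 / 144) t := fun t => by
    have h := (((hasDerivAt_id t).sub (((((hasDerivAt_pow 3 t).div_const 3).sub
      (((hasDerivAt_pow 2 t).const_mul (a + 1 / 2)).div_const 2)).add
      ((hasDerivAt_id t).const_mul (a / 2))).const_mul (1 / 6))).add
      ((hasDerivAt_id t).const_mul (1 / 144)))
    refine h.congr_deriv ?_
    push_cast
    ring
  rw [intervalIntegral.integral_eq_sub_of_hasDerivAt (fun t _ => hF t)
    (Continuous.intervalIntegrable (by fun_prop) _ _)]
  have := Real.add_one_le_exp (-(1 / 144) : ℝ)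
  refine le_trans (le_of_eq ?_) this
  ring

/-- Chernoff bound: the exponential moment factorizes over the coordinates, and the threshold `d /
48` costs the factor `exp (d / 288)`, half of the gained exponent `d / 144`. -/
theorem spread_unitCube (d : ℕ) : Spread (unitCube d) (1 / 2) (1 / 48) (Real.exp (-(1 / 288))) := by
  refine ⟨isOpen_unitCube, volume_unitCube, WithLp.toLp 2 fun _ => 1 / 2, fun x hx => ?_,
    fun p hp => ?_⟩
  · have h := norm_le_of_forall_abs_le (δ := 1 / 2) (by norm_num)
      (t := x - WithLp.toLp 2 fun _ => 1 / 2) fun i => ?_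
    · rwa [Fintype.card_fin] at h
    · rw [PiLp.sub_apply]
      exact abs_le.2 ⟨by linarith [(hx i).1], by linarith [(hx i).2]⟩
  · let h : Fin d → ℝ → ℝ := fun i => Set.indicator (Set.Ioo 0 1)
      fun t => Real.exp (-(1 / 6) * ((t - p i) * (t - 1 / 2)))
    have h0 : ∀ i t, 0 ≤ h i t := fun i t => Set.indicator_nonneg (fun _ _ => (Real.exp_pos _).le) t
    have hint : ∀ i, Integrable (h i) := fun i => by
      rw [integrable_indicator_iff measurableSet_Ioo]
      exact (Continuous.integrableOn_Icc (by fun_prop)).mono_set Set.Ioo_subset_Icc_self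
    refine (measure_le_ofReal_integral ((integrable_euclidean_prod hint).const_mul
      (Real.exp (d / 288))) (fun x => ?_) fun x hx => ?_).trans ?_
    · exact mul_nonneg (Real.exp_pos _).le (Finset.prod_nonneg fun i _ => h0 i _)
    · obtain ⟨hx, hlt⟩ := hx
      have hprod : ∏ i, h i (x i) = ∏ i, Real.exp (-(1 / 6) * ((x i - p i) * (x i - 1 / 2))) :=
        Finset.prod_congr rfl fun i _ => Set.indicator_of_mem (hx i) _
      rw [hprod, ← Real.exp_sum, ← Real.exp_add, Real.one_le_exp_iff, ← Finset.mul_sum]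
      rw [PiLp.inner_apply] at hlt
      simp only [PiLp.sub_apply, RCLike.inner_apply, conj_trivial] at hlt
      have : ∑ i, (x i - p i) * (x i - 1 / 2) = ∑ i, (x i - 1 / 2) * (x i - p i) :=
        Finset.sum_congr rfl fun i _ => mul_comm _ _
      rw [this]
      linarith
    · refine ENNReal.ofReal_le_ofReal ?_
      rw [integral_const_mul, integral_euclidean_prod]
      calc Real.exp (d / 288) * ∏ i, ∫ t, h i t
          ≤ Real.exp (d / 288) * ∏ _i : Fin d, Real.exp (-(1 / 144)) := by
            refine mul_le_mul_of_nonneg_left (Finset.prod_le_prod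
              (fun i _ => integral_nonneg (h0 i)) fun i _ => ?_) (Real.exp_pos _).le
            simp only [h]
            rw [integral_indicator measurableSet_Ioo]
            exact integral_exp_parabola_le (hp i)
        _ = Real.exp (-(1 / 288)) ^ d := by
            rw [Finset.prod_const, Finset.card_univ, Fintype.card_fin, ← Real.exp_nat_mul,
              ← Real.exp_nat_mul, ← Real.exp_add]
            ring_nf

end Cube

section SmallRadius

open scoped InnerProductSpace

/-- Comparison of the indicator with `exp (d / 2)` times a Gaussian of variance `u`, whose integral
is `(2 π u) ^ (d / 2)`. -/
theorem volume_ball_le {d : ℕ} (m : EuclideanSpace ℝ (Fin d)) {u : ℝ} (hu : 0 < u) :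
    volume {x | ‖x - m‖ ^ 2 < u * d} ≤
      ENNReal.ofReal (√(2 * Real.pi * Real.exp 1 * u) ^ d) := by
  have hb : 0 < 1 / (2 * u) := by positivity
  have hint : Integrable fun x : EuclideanSpace ℝ (Fin d) =>
      Real.exp (-(1 / (2 * u)) * ‖x‖ ^ 2) := by
    refine Integrable.of_integral_ne_zero ?_
    rw [GaussianFourier.integral_rexp_neg_mul_sq_norm hb]
    positivity
  refine (measure_le_ofReal_integral (((hint.comp_sub_right m)).const_mul
      (Real.exp (d / 2))) (fun x => by positivity) fun x hx => ?_).trans (le_of_eq ?_)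
  · rw [← Real.exp_add, Real.one_le_exp_iff]
    have hx' : ‖x - m‖ ^ 2 < u * d := hx
    have : -(1 / (2 * u)) * ‖x - m‖ ^ 2 = -(‖x - m‖ ^ 2 / (2 * u)) := by ring
    rw [this]
    have : ‖x - m‖ ^ 2 / (2 * u) ≤ d / 2 := by
      rw [div_le_div_iff₀ (by positivity) two_pos]
      linarith
    linarith
  · congr 1
    rw [integral_const_mul, integral_sub_right_eq_self (μ := volume)
      (fun x : EuclideanSpace ℝ (Fin d) => Real.exp (-(1 / (2 * u)) * ‖x‖ ^ 2)) m,
      GaussianFourier.integral_rexp_neg_mul_sq_norm hb, finrank_euclideanSpace_fin,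
      Real.sqrt_eq_rpow, ← Real.rpow_natCast, ← Real.rpow_mul (by positivity),
      show (d : ℝ) / 2 = 1 * (1 / 2 * d) by ring, Real.exp_mul, one_mul,
      ← Real.mul_rpow (by positivity) (by positivity)]
    congr 1
    field_simp

/-- With the midpoint `m` of `p` and `z`, `⟪x - p, x - z⟫ = ‖x - m‖ ^ 2 - ‖p - z‖ ^ 2 / 4`. The
exceptional set thus lies in a ball of squared radius `(c + r ^ 2 / 4) * d`, and the volume bound
decays when `c + r ^ 2 / 4 < 1 / (2 π e)`. The radius hypothesis leaves room for this; `c` is half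
of the gap. -/
theorem exists_spread_of_smallRadius {D : (d : ℕ) → Set (EuclideanSpace ℝ (Fin d))}
    (hD : OpenUnitVolume D) (hr : SmallRadius D) :
    ∃ R c q : ℝ, 0 < R ∧ 0 < c ∧ 0 < q ∧ q < 1 ∧ ∀ᶠ d in atTop, Spread (D d) R c q := by
  obtain ⟨r, hr0, hlr, hrt⟩ := ENNReal.lt_iff_exists_real_btwn.1 hr
  have hrpos : 0 < r := by
    by_contra! h
    rw [ENNReal.ofReal_of_nonpos h] at hlr
    exact not_lt_zero hlr
  have hpe : 0 < Real.pi * Real.exp 1 := by positivity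
  have hr2 : r ^ 2 < 2 / (Real.pi * Real.exp 1) := by
    have h := (ENNReal.ofReal_lt_ofReal_iff_of_nonneg hr0).1 hrt
    exact (Real.lt_sqrt hr0).1 h
  rw [lt_div_iff₀ hpe] at hr2
  set c := (1 / (2 * (Real.pi * Real.exp 1)) - r ^ 2 / 4) / 2 with hc
  have hc0 : 0 < c := by
    have : r ^ 2 / 4 < 1 / (2 * (Real.pi * Real.exp 1)) := by
      rw [lt_div_iff₀ (by positivity)]
      linarith
    simp only [hc]
    linarith
  set u := c + r ^ 2 / 4 with hu
  have hu0 : 0 < u := by positivity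
  refine ⟨r, c, √(2 * Real.pi * Real.exp 1 * u), hrpos, hc0, by positivity, ?_, ?_⟩
  · rw [Real.sqrt_lt' one_pos]
    have h1 : 2 * Real.pi * Real.exp 1 * u =
        1 / 2 + (r ^ 2 * (Real.pi * Real.exp 1)) / 4 := by
      rw [hu, hc]
      field_simp
      ring
    rw [h1]
    linarith
  · filter_upwards [eventually_lt_of_limsup_lt hlr, eventually_ge_atTop 1] with d hd hd1
    have hsd : 0 < √(d : ℝ) := Real.sqrt_pos.2 (by exact_mod_cast hd1)
    rw [ENNReal.div_lt_iff (.inl (by simpa using Nat.pos_of_ne_zero (by omega))) (.inl ENNReal.ofReal_ne_top),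
      ← ENNReal.ofReal_mul hr0, radius, iInf_lt_iff] at hd
    obtain ⟨z, hz⟩ := hd
    have hDz : ∀ x ∈ D d, ‖x - z‖ ≤ r * √d := fun x hx => by
      have h := ((le_iSup₂ (f := fun y (_ : y ∈ D d) => edist y z) x hx).trans_lt hz).le
      rw [edist_dist, ENNReal.ofReal_le_ofReal_iff (by positivity), dist_eq_norm] at h
      exact h
    refine ⟨(hD d hd1).1, (hD d hd1).2, z, hDz, fun p hp => ?_⟩
    refine (measure_mono fun x hx => ?_).trans (volume_ball_le ((1 / 2 : ℝ) • (p + z)) hu0)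
    have h1 : ⟪x - p, x - z⟫_ℝ < c * d := hx.2
    have h2 : ‖p - z‖ ^ 2 ≤ r ^ 2 * d := by
      have := pow_le_pow_left₀ (norm_nonneg _) (hDz p hp) 2
      rwa [mul_pow, Real.sq_sqrt (Nat.cast_nonneg d)] at this
    have e1 : x - (1 / 2 : ℝ) • (p + z) = (1 / 2 : ℝ) • ((x - p) + (x - z)) := by module
    have e2 : p - z = (x - z) - (x - p) := by abel
    have h3 : ‖x - (1 / 2 : ℝ) • (p + z)‖ ^ 2 = ⟪x - p, x - z⟫_ℝ + ‖p - z‖ ^ 2 / 4 := by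
      rw [e1, e2, norm_smul, mul_pow, norm_add_sq_real, norm_sub_sq_real (x - z),
        real_inner_comm (x - p) (x - z)]
      norm_num
      ring
    change ‖x - (1 / 2 : ℝ) • (p + z)‖ ^ 2 < u * d
    rw [h3, hu]
    linarith

end SmallRadius

/-! ### Fooling functions and the curse of dimensionality -/

section LowerBound

variable {d : ℕ}

theorem smul_mem_smoothClass {k : ℕ} {D : Set (EuclideanSpace ℝ (Fin d))} {L : ℕ → ℝ}
    {F : EuclideanSpace ℝ (Fin d) → ℝ} (hF : ContDiff ℝ k F) {s : ℝ}
    (h0 : ∀ x ∈ D, |s| * |F x| ≤ 1)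
    (h : ∀ j ≤ k, ∀ x ∈ D, ∀ y ∈ D,
      |s| * ‖iteratedFDeriv ℝ j F x - iteratedFDeriv ℝ j F y‖ ≤ L j * ‖x - y‖) :
    s • F ∈ smoothClass k D L := by
  refine ⟨(contDiff_const.smul hF).contDiffOn, fun x hx => ?_, fun j hj x hx y hy => ?_⟩
  · rw [Pi.smul_apply, smul_eq_mul, abs_mul]
    exact h0 x hx
  · have hFj : ContDiff ℝ j F := hF.of_le (by exact_mod_cast hj)
    rw [iteratedFDeriv_const_smul_apply hFj.contDiffAt,
      iteratedFDeriv_const_smul_apply hFj.contDiffAt, ← smul_sub, norm_smul, Real.norm_eq_abs]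
    exact h j hj x hx y hy

open scoped InnerProductSpace in
/-- A function of the class that vanishes at given points, but not in the mean. -/
theorem exists_fooling_function {k : ℕ} (hd : 1 ≤ d) {D : Set (EuclideanSpace ℝ (Fin d))}
    {R c q : ℝ} (hD : Spread D R c q) (hR : 0 < R) (hc : 0 < c) {δ C : ℝ} (hδ : 0 ≤ δ)
    (hC : 1 ≤ C) (hkδ : 2 * k * δ ≤ c / (2 * R)) {φ : EuclideanSpace ℝ (Fin d) → ℝ}
    (hφ : IsMollifier φ (δ * √d) C) {L : ℕ → ℝ} {η a : ℝ} (ha : 0 < a) (ha1 : 8 * R ^ 2 * a ≤ 1)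
    (ha2 : 4 * R * a ≤ η) (ha3 : 2 * C ^ k * a ≤ η) (h0 : η ≤ L 0 * √d)
    (hL : ∀ j, 1 ≤ j → j ≤ k → η ≤ L j * d) (P : Finset (EuclideanSpace ℝ (Fin d)))
    (hP : P.Nonempty) (hPD : ∀ p ∈ P, p ∈ D) (hcard : P.card * q ^ d ≤ 1 / 2) :
    ∃ f, f ∈ smoothClass k D L ∧ -f ∈ smoothClass k D L ∧ (∀ p ∈ P, f p = 0) ∧
      a * (c / (2 * R)) ^ 2 / 2 ≤ ∫ x in D, f x := by
  have hdpos : (0 : ℝ) < d := by exact_mod_cast hd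
  have hsd : 0 < √(d : ℝ) := Real.sqrt_pos.2 hdpos
  have hss : √(d : ℝ) * √d = d := Real.mul_self_sqrt hdpos.le
  obtain ⟨hopen, hvol, z, hz, hbad⟩ := hD
  obtain ⟨F, hF, hFP, hF0, hFg, hFl, hFlow⟩ := hφ.exists_smooth_sqDist (by positivity) hC k
    P.finite_toSet hP
  obtain ⟨p₀, hp₀⟩ := hP
  have hFdiff : Differentiable ℝ F := hF.differentiable (by simp)
  -- The nonnegative `F` has a minimum at its zero `p₀`, so its gradient vanishes there.
  have hgrad : ∀ x, ‖fderiv ℝ F x‖ ≤ 2 * ‖x - p₀‖ := fun x => by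
    have h1 : fderiv ℝ F p₀ = 0 := IsLocalMin.fderiv_eq_zero
      (.of_forall fun y => by rw [hFP p₀ hp₀]; exact hF0 y)
    have h2 := hFg x p₀
    rwa [h1, sub_zero] at h2
  have hball : ∀ x ∈ D, x ∈ Metric.closedBall z (R * √d) := fun x hx =>
    mem_closedBall_iff_norm.2 (hz x hx)
  -- `D` need not be convex; the mean value inequality is applied on the ball that contains it.
  have hlip : ∀ x ∈ D, ∀ y ∈ D, ‖F x - F y‖ ≤ 4 * R * √d * ‖x - y‖ := fun x hx y hy => by
    refine (convex_closedBall z (R * √d)).norm_image_sub_le_of_norm_fderiv_le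
      (fun w _ => hFdiff w) (fun w hw => (hgrad w).trans ?_) (hball y hy) (hball x hx)
    have h1 := mem_closedBall_iff_norm.1 hw
    have h2 := mem_closedBall_iff_norm'.1 (hball p₀ (hPD p₀ hp₀))
    have h3 := norm_sub_le_norm_sub_add_norm_sub w z p₀
    linarith
  have hFle : ∀ x ∈ D, F x ≤ 8 * R ^ 2 * d := fun x hx => by
    have h1 := hlip x hx p₀ (hPD p₀ hp₀)
    rw [hFP p₀ hp₀, sub_zero, Real.norm_of_nonneg (hF0 x)] at h1
    have h2 := mem_closedBall_iff_norm.1 (hball x hx)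
    have h3 := mem_closedBall_iff_norm'.1 (hball p₀ (hPD p₀ hp₀))
    have h4 := norm_sub_le_norm_sub_add_norm_sub x z p₀
    calc F x ≤ 4 * R * √d * ‖x - p₀‖ := h1
      _ ≤ 4 * R * √d * (2 * (R * √d)) :=
        mul_le_mul_of_nonneg_left (by linarith) (by positivity)
      _ = 8 * R ^ 2 * (√d * √d) := by ring
      _ = 8 * R ^ 2 * d := by rw [hss]
  have hmem : ∀ s : ℝ, |s| = a / d → s • F ∈ smoothClass k D L := fun s hs => by
    refine smul_mem_smoothClass (hF.of_le (by exact_mod_cast Nat.le_succ k)) (fun x hx => ?_)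
      fun j hj x hx y hy => ?_
    · rw [hs, abs_of_nonneg (hF0 x)]
      calc a / d * F x ≤ a / d * (8 * R ^ 2 * d) :=
            mul_le_mul_of_nonneg_left (hFle x hx) (by positivity)
        _ = 8 * R ^ 2 * a := by field_simp
        _ ≤ 1 := ha1
    · rw [hs]
      rcases Nat.eq_zero_or_pos j with rfl | hj0
      · simp only [iteratedFDeriv_zero_eq_comp, Function.comp_apply, ← map_sub,
          LinearIsometryEquiv.norm_map]
        calc a / d * ‖F x - F y‖ ≤ a / d * (4 * R * √d * ‖x - y‖) :=
              mul_le_mul_of_nonneg_left (hlip x hx y hy) (by positivity)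
          _ = 4 * R * a * √d / (√d * √d) * ‖x - y‖ := by rw [hss]; ring
          _ = 4 * R * a / √d * ‖x - y‖ := by field_simp
          _ ≤ L 0 * ‖x - y‖ := by
              refine mul_le_mul_of_nonneg_right ?_ (norm_nonneg _)
              rw [div_le_iff₀ hsd]
              exact ha2.trans h0
      · calc a / d * ‖iteratedFDeriv ℝ j F x - iteratedFDeriv ℝ j F y‖
            ≤ a / d * (2 * C ^ k * ‖x - y‖) :=
              mul_le_mul_of_nonneg_left (hFl j hj0 hj x y) (by positivity)
          _ = 2 * C ^ k * a / d * ‖x - y‖ := by ring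
          _ ≤ L j * ‖x - y‖ := by
              refine mul_le_mul_of_nonneg_right ?_ (norm_nonneg _)
              rw [div_le_iff₀ hdpos]
              exact ha3.trans (hL j hj0 hj)
  have hfar : ∀ x ∈ D, (∀ p ∈ P, c * d ≤ ⟪x - p, x - z⟫_ℝ) →
      a * (c / (2 * R)) ^ 2 ≤ (a / d) * F x := fun x hx h => by
    have hhull : ∀ w ∈ convexHull ℝ (P : Set (EuclideanSpace ℝ (Fin d))),
        c * d ≤ ⟪x - w, x - z⟫_ℝ := fun w hw => by
      have hconv : Convex ℝ {w | ⟪x - z, w⟫_ℝ ≤ ⟪x - z, x⟫_ℝ - c * d} :=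
        convex_halfSpace_le (innerSL ℝ (x - z)).isLinear _
      have hsub : ∀ w, w ∈ {w | ⟪x - z, w⟫_ℝ ≤ ⟪x - z, x⟫_ℝ - c * d} ↔
          c * d ≤ ⟪x - w, x - z⟫_ℝ := fun w => by
        rw [Set.mem_ofPred_eq, real_inner_comm (x - z) (x - w), inner_sub_right]
        constructor <;> intro h <;> linarith
      exact (hsub w).1 (convexHull_min (fun p hp => (hsub p).2 (h p hp)) hconv hw)
    have h1 : (c / (2 * R) * √d) ^ 2 ≤ F x := by
      refine hFlow x _ (by positivity) fun w hw => ?_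
      have h2 : c * d ≤ ‖x - w‖ * (R * √d) := (hhull w hw).trans
        ((real_inner_le_norm _ _).trans (mul_le_mul_of_nonneg_left (hz x hx) (norm_nonneg _)))
      have h3 : c / R * √d ≤ ‖x - w‖ := by
        refine le_of_mul_le_mul_right (a := R * √d) ?_ (by positivity)
        calc c / R * √d * (R * √d) = c * (√d * √d) := by field_simp
          _ = c * d := by rw [hss]
          _ ≤ _ := h2
      have h4 : 2 * k * δ * √d ≤ c / (2 * R) * √d := mul_le_mul_of_nonneg_right hkδ hsd.le
      have h5 : c / (2 * R) * √d + c / (2 * R) * √d = c / R * √d := by field_simp; ring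
      linarith
    rw [mul_pow, Real.sq_sqrt hdpos.le] at h1
    calc a * (c / (2 * R)) ^ 2 = a / d * ((c / (2 * R)) ^ 2 * d) := by field_simp
      _ ≤ a / d * F x := mul_le_mul_of_nonneg_left h1 (by positivity)
  have hs : |a / d| = a / d := abs_of_pos (by positivity)
  refine ⟨(a / d) • F, hmem _ hs, ?_, fun p hp => ?_, ?_⟩
  · rw [← neg_smul]
    exact hmem _ (by rw [abs_neg, hs])
  · simp [hFP p hp]
  · set K := a * (c / (2 * R)) ^ 2 with hK
    have hfc : Continuous ((a / d) • F) := hF.continuous.const_smul _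
    have hfin : volume D ≠ ∞ := by simp [hvol]
    have hint : IntegrableOn ((a / d) • F) D := by
      refine IntegrableOn.of_bound hfin.lt_top hfc.aestronglyMeasurable 1 ?_
      exact (ae_restrict_iff' hopen.measurableSet).2 (.of_forall (hmem _ hs).2.1)
    have h1 := mul_meas_ge_le_integral_of_nonneg (μ := volume.restrict D)
      (f := (a / d) • F) (.of_forall fun x => mul_nonneg (by positivity) (hF0 x)) hint K
    refine le_trans ?_ h1
    rw [div_eq_mul_one_div]
    refine mul_le_mul_of_nonneg_left ?_ (by positivity)
    have hms : MeasurableSet {x | K ≤ ((a / d) • F) x} := measurableSet_le measurable_const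
      hfc.measurable
    rw [measureReal_def, Measure.restrict_apply hms]
    have hcover : D ⊆ ({x | K ≤ ((a / d) • F) x} ∩ D) ∪
        ⋃ p ∈ P, {x ∈ D | ⟪x - p, x - z⟫_ℝ < c * d} := fun x hx => by
      by_cases h : ∀ p ∈ P, c * d ≤ ⟪x - p, x - z⟫_ℝ
      · exact .inl ⟨hfar x hx h, hx⟩
      · push Not at h
        obtain ⟨p, hp, hlt⟩ := h
        exact .inr (Set.mem_biUnion hp ⟨hx, hlt⟩)
    have hB : volume (⋃ p ∈ P, {x ∈ D | ⟪x - p, x - z⟫_ℝ < c * d}) ≤ ENNReal.ofReal (1 / 2) := by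
      refine (measure_biUnion_finset_le P _).trans ?_
      refine (Finset.sum_le_sum fun p hp => hbad p (hPD p hp)).trans ?_
      rw [Finset.sum_const, nsmul_eq_mul, ← ENNReal.ofReal_natCast,
        ← ENNReal.ofReal_mul (Nat.cast_nonneg _)]
      exact ENNReal.ofReal_le_ofReal hcard
    have hle := (measure_mono hcover).trans ((measure_union_le _ _).trans (add_le_add_right hB _))
    have hA : volume ({x | K ≤ ((a / d) • F) x} ∩ D) ≠ ∞ :=
      measure_ne_top_of_subset Set.inter_subset_right hfin
    rw [hvol, ← ENNReal.ofReal_toReal hA, ← ENNReal.ofReal_add ENNReal.toReal_nonneg (by norm_num),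
      ← ENNReal.ofReal_one, ENNReal.ofReal_le_ofReal_iff (by positivity)] at hle
    linarith

/-- The curse of dimensionality holds along the dimensions with spread domains and Lipschitz
constants that are not too small. -/
theorem curse_of_spread {k : ℕ} {L : ℕ → ℕ → ℝ} {D : (d : ℕ) → Set (EuclideanSpace ℝ (Fin d))}
    {R c q : ℝ} (hR : 0 < R) (hc : 0 < c) (hq : 0 < q) (hq1 : q < 1)
    (hD : ∀ᶠ d in atTop, Spread (D d) R c q) {η : ℝ} (hη : 0 < η)
    (hL : ∃ᶠ d : ℕ in atTop, η ≤ L 0 d * √d ∧ ∀ j, 1 ≤ j → j ≤ k → η ≤ L j d * d) :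
    Curse D fun d => smoothClass k (D d) fun j => L j d := by
  -- The denominator is `2 * k + 1` so that `k = 0` is covered.
  set δ := c / (2 * R) / (2 * k + 1) with hδdef
  have hδ : 0 < δ := by positivity
  have hkδ : 2 * k * δ ≤ c / (2 * R) := by
    rw [hδdef, mul_div_assoc', div_le_iff₀ (by positivity)]
    nlinarith [show 0 < c / (2 * R) by positivity]
  obtain ⟨C, hC, hφ⟩ := exists_isMollifier hδ
  set a := min (1 / (8 * R ^ 2)) (min (η / (4 * R)) (η / (2 * C ^ k))) with hadef
  have ha : 0 < a := by positivity
  have ha1 : 8 * R ^ 2 * a ≤ 1 := by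
    rw [mul_comm, ← le_div_iff₀ (by positivity)]
    exact min_le_left _ _
  have ha2 : 4 * R * a ≤ η := by
    rw [mul_comm, ← le_div_iff₀ (by positivity)]
    exact (min_le_right _ _).trans (min_le_left _ _)
  have ha3 : 2 * C ^ k * a ≤ η := by
    rw [mul_comm, ← le_div_iff₀ (by positivity)]
    exact (min_le_right _ _).trans (min_le_right _ _)
  have hK : 0 < a * (c / (2 * R)) ^ 2 / 2 := by positivity
  -- The base `1 + γ` is `q⁻¹`; the last halving makes the error bound strict.
  refine ⟨1 / 4, a * (c / (2 * R)) ^ 2 / 2 / 2, q⁻¹ - 1, by norm_num, by positivity,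
    sub_pos.2 ((one_lt_inv₀ hq).2 hq1), fun ε hε hεle => ?_⟩
  have hqd : ∀ᶠ d : ℕ in atTop, q ^ d < 1 / 4 :=
    (tendsto_pow_atTop_nhds_zero_of_lt_one hq.le hq1).eventually_lt_const (by norm_num)
  refine (hL.and_eventually (hD.and (hqd.and (eventually_ge_atTop 1)))).mono ?_
  rintro d ⟨⟨hL0, hLj⟩, hDd, hqd, hd⟩
  rw [add_sub_cancel]
  refine ofReal_le_infoComplexity fun n hn A => A.lt_error hε.le fun p hp => ?_
  -- The extra point keeps the node set nonempty when `n = 0`.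
  obtain ⟨x₀, hx₀⟩ : (D d).Nonempty := by
    by_contra h
    have := hDd.2.1
    rw [Set.not_nonempty_iff_eq_empty.1 h] at this
    simp at this
  classical
  obtain ⟨φ, hφd⟩ := hφ d
  have hcard : ((insert x₀ (Finset.univ.image p)).card : ℝ) * q ^ d ≤ 1 / 2 := by
    have h1 : (insert x₀ (Finset.univ.image p)).card ≤ n + 1 :=
      (Finset.card_insert_le _ _).trans (Nat.succ_le_succ (Finset.card_image_le.trans (by simp)))
    have h2 : ((insert x₀ (Finset.univ.image p)).card : ℝ) ≤ n + 1 := by exact_mod_cast h1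
    have hqp : 0 < q ^ d := by positivity
    have h3 : (n : ℝ) * q ^ d ≤ 1 / 4 := by
      rw [inv_pow, ← div_eq_mul_inv, lt_div_iff₀ hqp] at hn
      exact hn.le
    calc _ ≤ ((n : ℝ) + 1) * q ^ d := mul_le_mul_of_nonneg_right h2 hqp.le
      _ ≤ 1 / 2 := by linarith
  obtain ⟨f, hf, hf', hfP, hint⟩ := exists_fooling_function hd hDd hR hc hδ.le hC hkδ hφd ha ha1
    ha2 ha3 hL0 hLj (insert x₀ (Finset.univ.image p)) (Finset.insert_nonempty _ _)
    (fun y hy => by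
      rcases Finset.mem_insert.1 hy with rfl | hy
      · exact hx₀
      · obtain ⟨i, -, rfl⟩ := Finset.mem_image.1 hy
        exact hp i) hcard
  exact ⟨f, hf, hf', fun i => hfP _ (Finset.mem_insert_of_mem
    (Finset.mem_image_of_mem p (Finset.mem_univ i))), by linarith⟩

theorem curse_of_limsup_pos {k : ℕ} {L : ℕ → ℕ → ℝ} {D : (d : ℕ) → Set (EuclideanSpace ℝ (Fin d))}
    (hD : (∀ d, 1 ≤ d → D d = unitCube d) ∨ (OpenUnitVolume D ∧ SmallRadius D))
    (hL : 0 < limsup (fun d : ℕ => min ((L 0 d * √(d : ℝ) : ℝ) : EReal)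
      (⨅ j ∈ Finset.Icc 1 k, ((L j d * (d : ℝ) : ℝ) : EReal))) atTop) :
    Curse D fun d => smoothClass k (D d) fun j => L j d := by
  obtain ⟨η, hη, hηL⟩ := EReal.lt_iff_exists_real_btwn.1 hL
  have hfreq : ∃ᶠ d : ℕ in atTop, η ≤ L 0 d * √d ∧ ∀ j, 1 ≤ j → j ≤ k → η ≤ L j d * d := by
    refine (frequently_lt_of_lt_limsup (by isBoundedDefault) hηL).mono fun d hd => ?_
    obtain ⟨h1, h2⟩ := lt_min_iff.1 hd
    refine ⟨by exact_mod_cast h1.le, fun j hj hjk => ?_⟩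
    exact EReal.coe_le_coe_iff.1 (h2.le.trans (iInf₂_le j (Finset.mem_Icc.2 ⟨hj, hjk⟩)))
  have hη' : 0 < η := by exact_mod_cast hη
  rcases hD with hD | ⟨hD, hr⟩
  · refine curse_of_spread (R := 1 / 2) (c := 1 / 48) (q := Real.exp (-(1 / 288))) (by norm_num)
      (by norm_num) (Real.exp_pos _) (Real.exp_lt_one_iff.2 (by norm_num)) ?_ hη' hfreq
    filter_upwards [eventually_ge_atTop 1] with d hd
    rw [hD d hd]
    exact spread_unitCube d
  · obtain ⟨R, c, q, hR, hc, hq, hq1, hs⟩ := exists_spread_of_smallRadius hD hr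
    exact curse_of_spread hR hc hq hq1 hs hη' hfreq

end LowerBound

/-! ### Taylor approximation -/

section Taylor

/-- The derivative of the remainder of `G 0` is the remainder of `G 1` of one order less. Since the
interval has length one, the mean value inequality preserves the bound `C`. -/
theorem abs_sub_sum_le_of_hasDerivAt {C : ℝ} : ∀ (j : ℕ) {G : ℕ → ℝ → ℝ},
    (∀ i < j, ∀ t ∈ Set.Icc (0 : ℝ) 1, HasDerivAt (G i) (G (i + 1) t) t) →
    (∀ t ∈ Set.Icc (0 : ℝ) 1, |G j t - G j 0| ≤ C) → ∀ t ∈ Set.Icc (0 : ℝ) 1,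
    |G 0 t - ∑ i ∈ Finset.range (j + 1), t ^ i / i.factorial * G i 0| ≤ C
  | 0, G, _, h, t, ht => by simpa using h t ht
  | j + 1, G, hG, h, t, ht => by
    have ih := abs_sub_sum_le_of_hasDerivAt j (G := fun i => G (i + 1))
      (fun i hi => hG (i + 1) (by omega)) h
    have h0 : (0 : ℝ) ∈ Set.Icc (0 : ℝ) 1 := ⟨le_rfl, zero_le_one⟩
    have hC : 0 ≤ C := (abs_nonneg _).trans (h 0 h0)
    have hd : ∀ s ∈ Set.Icc (0 : ℝ) 1, HasDerivWithinAt
        (fun t => G 0 t - ∑ i ∈ Finset.range (j + 2), t ^ i / i.factorial * G i 0)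
        (G 1 s - ∑ i ∈ Finset.range (j + 1), s ^ i / i.factorial * G (i + 1) 0)
        (Set.Icc 0 1) s := fun s hs => by
      simp only [Finset.sum_range_succ' _ (j + 1)]
      have h1 : HasDerivAt (fun t : ℝ => ∑ i ∈ Finset.range (j + 1),
          t ^ (i + 1) / (i + 1).factorial * G (i + 1) 0)
          (∑ i ∈ Finset.range (j + 1), s ^ i / i.factorial * G (i + 1) 0) s := by
        refine HasDerivAt.fun_sum fun i _ => ?_
        refine HasDerivAt.mul_const ?_ _
        refine ((hasDerivAt_pow (i + 1) s).div_const _).congr_deriv ?_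
        rw [Nat.factorial_succ]
        push_cast
        field_simp
      have h2 := (hG 0 (Nat.succ_pos j) s hs).fun_sub (h1.add_const (G 0 0))
      simpa using h2.hasDerivWithinAt
    have hm := (convex_Icc (0 : ℝ) 1).norm_image_sub_le_of_norm_hasDerivWithin_le hd ih h0 ht
    have hz : G 0 0 - ∑ i ∈ Finset.range (j + 2), (0 : ℝ) ^ i / i.factorial * G i 0 = 0 := by
      simp [Finset.sum_range_succ' _ (j + 1)]
    rw [hz, sub_zero, sub_zero, Real.norm_eq_abs, Real.norm_of_nonneg ht.1] at hm
    exact hm.trans (mul_le_of_le_one_right hC ht.2)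

variable {E : Type*} [NormedAddCommGroup E] [NormedSpace ℝ E]

/-- Taylor's formula with a Lipschitz bound for the highest derivative. -/
theorem abs_sub_taylor_le {D : Set E} (ho : IsOpen D) (hc : Convex ℝ D) {f : E → ℝ} {j : ℕ}
    (hf : ContDiffOn ℝ j f D) {M : ℝ} {x₀ x : E} (hx₀ : x₀ ∈ D) (hx : x ∈ D) (hM : 0 ≤ M)
    (hlip : ∀ y ∈ D, ‖iteratedFDeriv ℝ j f y - iteratedFDeriv ℝ j f x₀‖ ≤ M * ‖y - x₀‖) :
    |f x - ∑ i ∈ Finset.range (j + 1),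
      (1 / i.factorial : ℝ) * iteratedFDeriv ℝ i f x₀ (fun _ => x - x₀)| ≤
        M * ‖x - x₀‖ ^ (j + 1) := by
  set v := x - x₀ with hv
  have hmem : ∀ t ∈ Set.Icc (0 : ℝ) 1, x₀ + t • v ∈ D := fun t ht =>
    hc.add_smul_sub_mem hx₀ hx ht
  have h1 : (1 : ℝ) ∈ Set.Icc (0 : ℝ) 1 := ⟨zero_le_one, le_rfl⟩
  have key := abs_sub_sum_le_of_hasDerivAt (C := M * ‖v‖ ^ (j + 1)) j
    (G := fun i t => iteratedFDeriv ℝ i f (x₀ + t • v) fun _ => v) (fun i hi t ht => ?_)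
    (fun t ht => ?_) 1 h1
  · simpa [hv] using key
  · have hat : ContDiffAt ℝ j f (x₀ + t • v) := hf.contDiffAt (ho.mem_nhds (hmem t ht))
    have hd : DifferentiableAt ℝ (iteratedFDeriv ℝ i f) (x₀ + t • v) :=
      hat.differentiableAt_iteratedFDeriv (by exact_mod_cast hi)
    have hline : HasDerivAt (fun t : ℝ => x₀ + t • v) v t := by
      simpa using ((hasDerivAt_id t).smul_const v).const_add x₀
    have h2 := hd.hasFDerivAt.comp_hasDerivAt t hline
    have h3 := (ContinuousMultilinearMap.apply ℝ (fun _ : Fin i => E) ℝ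
      (fun _ => v)).hasFDerivAt.comp_hasDerivAt t h2
    rw [iteratedFDeriv_succ_apply_left]
    exact h3
  · simp only [zero_smul, add_zero]
    rw [← _root_.sub_apply, ← Real.norm_eq_abs]
    refine (ContinuousMultilinearMap.le_opNorm _ _).trans ?_
    have h2 := hlip _ (hmem t ht)
    rw [add_sub_cancel_left, norm_smul, Real.norm_of_nonneg ht.1] at h2
    rw [Finset.prod_const, Finset.card_univ, Fintype.card_fin, pow_succ', ← mul_assoc]
    refine mul_le_mul_of_nonneg_right (h2.trans ?_) (by positivity)
    exact mul_le_mul_of_nonneg_left (mul_le_of_le_one_left (norm_nonneg v) ht.2) hM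

end Taylor

/-! ### Interpolation nodes and polynomial spaces -/

section Unisolvent

/-- A finite-dimensional space of functions has a set of interpolation nodes. -/
theorem exists_unisolvent {X : Type*} (V : Submodule ℝ (X → ℝ)) [FiniteDimensional ℝ V] :
    ∃ (y : Fin (Module.finrank ℝ V) → X) (l : Fin (Module.finrank ℝ V) → X → ℝ),
      (∀ i, l i ∈ V) ∧ ∀ p ∈ V, ∀ x, p x = ∑ i, p (y i) * l i x := by
  let ev : X → Module.Dual ℝ V := fun x => (LinearMap.proj x).comp V.subtype
  -- A functional on the dual that kills all evaluations is, by reflexivity, an element of `V` that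
  -- vanishes everywhere. The nodes come from a basis of evaluations, and `l` is its dual basis.
  have hspan : ⊤ ≤ Submodule.span ℝ (Set.range ev) := by
    by_contra h
    obtain ⟨F, hF, hker⟩ := Submodule.exists_le_ker_of_lt_top _ (lt_top_iff_ne_top.2
      fun h' => h h'.ge)
    refine hF ?_
    have hz : (Module.evalEquiv ℝ V).symm F = 0 := by
      ext x
      have h1 : F (ev x) = 0 := hker (Submodule.subset_span ⟨x, rfl⟩)
      rw [← Module.apply_evalEquiv_symm_apply] at h1
      exact h1
    simpa using hz
  obtain ⟨κ, b, hb⟩ : ∃ (κ : Set (Module.Dual ℝ V)) (b : Module.Basis κ ℝ (Module.Dual ℝ V)),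
    Set.range b ⊆ Set.range ev := ⟨_, _, Module.Basis.ofSpan_subset hspan⟩
  have : Fintype κ := FiniteDimensional.fintypeBasisIndex b
  have hcard : Fintype.card κ = Module.finrank ℝ V := by
    rw [← Module.finrank_eq_card_basis b, Subspace.dual_finrank_eq]
  let b' := b.reindex (Fintype.equivFinOfCardEq hcard)
  have hb' : ∀ i, ∃ x, ev x = b' i := fun i => by
    rw [Module.Basis.reindex_apply]
    exact hb ⟨_, rfl⟩
  choose y hy using hb'
  refine ⟨y, fun i => ((Module.evalEquiv ℝ V).symm (b'.coord i) : V), fun i => SetLike.coe_mem _,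
    fun p hp x => ?_⟩
  have h1 : (∑ i, b'.repr (ev x) i • b' i) ⟨p, hp⟩ = ev x ⟨p, hp⟩ := by rw [b'.sum_repr]
  rw [LinearMap.sum_apply] at h1
  have h2 : ∀ i, ((Module.evalEquiv ℝ V).symm (b'.coord i) : X → ℝ) x = b'.repr (ev x) i :=
    fun i => Module.apply_evalEquiv_symm_apply (R := ℝ) (M := V) (ev x) (b'.coord i)
  simp only [h2]
  refine h1.symm.trans (Finset.sum_congr rfl fun i _ => ?_)
  rw [mul_comm, ← hy i]
  rfl

end Unisolvent

section Polynomials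

variable {ι : Type*}

/-- A product of `j` factors, each of them a coordinate or `1`. -/
noncomputable def monomialFun (j : ℕ) (s : Fin j → Option ι) (y : EuclideanSpace ℝ ι) : ℝ :=
  ∏ i, (s i).elim 1 fun l => y l

/-- The space of polynomial functions of degree at most `j`. -/
noncomputable def polyFun (ι : Type*) (j : ℕ) : Submodule ℝ (EuclideanSpace ℝ ι → ℝ) :=
  Submodule.span ℝ (Set.range (monomialFun j))

variable [Fintype ι]

instance (j : ℕ) : FiniteDimensional ℝ (polyFun ι j) := by
  classical
  exact FiniteDimensional.span_of_finite ℝ (Set.finite_range _)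

theorem finrank_polyFun_le (j : ℕ) :
    Module.finrank ℝ (polyFun ι j) ≤ (Fintype.card ι + 1) ^ j := by
  classical
  refine (finrank_range_le_card (R := ℝ) (monomialFun (ι := ι) j)).trans_eq ?_
  simp

omit [Fintype ι] in
theorem continuous_of_mem_polyFun {j : ℕ} {p : EuclideanSpace ℝ ι → ℝ} (hp : p ∈ polyFun ι j) :
    Continuous p := by
  induction hp using Submodule.span_induction with
  | mem p hp =>
    obtain ⟨s, rfl⟩ := hp
    refine continuous_finsetProd _ fun i _ => ?_
    cases s i with
    | none => exact continuous_const
    | some l => exact (EuclideanSpace.proj l : EuclideanSpace ℝ ι →L[ℝ] ℝ).continuous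
  | zero => exact continuous_zero
  | add p q _ _ hp hq => exact hp.add hq
  | smul a p _ hp => exact hp.const_smul a

/-- The growth order `j` limits the weights of the contracted cubature formula to order `h ^ (-j)`.
-/
theorem exists_bound_of_mem_polyFun {j : ℕ} {p : EuclideanSpace ℝ ι → ℝ} (hp : p ∈ polyFun ι j) :
    ∃ C, 0 ≤ C ∧ ∀ y, |p y| ≤ C * max 1 ‖y‖ ^ j := by
  induction hp using Submodule.span_induction with
  | mem p hp =>
    obtain ⟨s, rfl⟩ := hp
    refine ⟨1, zero_le_one, fun y => ?_⟩
    rw [monomialFun, Finset.abs_prod, one_mul]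
    refine (Finset.prod_le_prod (g := fun _ => max 1 ‖y‖) (fun i _ => abs_nonneg _)
      fun i _ => ?_).trans_eq (by simp)
    cases s i with
    | none => simp
    | some l => exact (PiLp.norm_apply_le y l).trans (le_max_right _ _)
  | zero => exact ⟨0, le_rfl, fun y => by simp⟩
  | add p q _ _ hp hq =>
    obtain ⟨C, hC, hp⟩ := hp
    obtain ⟨C', hC', hq⟩ := hq
    refine ⟨C + C', by positivity, fun y => ?_⟩
    rw [add_mul]
    exact (abs_add_le _ _).trans (add_le_add (hp y) (hq y))
  | smul a p _ hp =>
    obtain ⟨C, hC, hp⟩ := hp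
    refine ⟨|a| * C, by positivity, fun y => ?_⟩
    rw [Pi.smul_apply, smul_eq_mul, abs_mul, mul_assoc]
    exact mul_le_mul_of_nonneg_left (hp y) (abs_nonneg a)

/-- Expansion in the standard basis; the missing `j - i` factors are filled with `none`. -/
theorem multilinear_mem_polyFun {i j : ℕ} (hij : i ≤ j)
    (A : MultilinearMap ℝ (fun _ : Fin i => EuclideanSpace ℝ ι) ℝ) :
    (fun y => A fun _ => y) ∈ polyFun ι j := by
  classical
  obtain ⟨r, rfl⟩ := Nat.exists_eq_add_of_le hij
  have h : (fun y => A fun _ => y) = ∑ s : Fin i → ι,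
      A (fun m => EuclideanSpace.basisFun ι ℝ (s m)) •
        monomialFun (i + r) (Fin.append (fun m => some (s m)) fun _ => none) := by
    ext y
    have hy : y = ∑ l, y l • EuclideanSpace.basisFun ι ℝ l := by
      conv_lhs => rw [← (EuclideanSpace.basisFun ι ℝ).sum_repr y]
      simp
    conv_lhs => rw [hy, MultilinearMap.map_sum]
    rw [Finset.sum_apply]
    refine Finset.sum_congr rfl fun s _ => ?_
    rw [A.map_smul_univ, Pi.smul_apply, smul_eq_mul, smul_eq_mul, mul_comm, monomialFun,
      Fin.prod_univ_add]
    simp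
  rw [h]
  exact Submodule.sum_mem _ fun s _ => Submodule.smul_mem _ _ (Submodule.subset_span ⟨_, rfl⟩)

end Polynomials

/-! ### Cubature by Taylor polynomials and the polynomial upper bound -/

section UpperBound

variable {d : ℕ}

theorem exists_scale (s : Finset ℝ) {K ε : ℝ} (hε : 0 < ε) {r : ℝ} (hr : 0 < r) :
    ∃ h : ℝ, 0 < h ∧ h ≤ 1 ∧ h * K ≤ ε ∧ ∀ t ∈ s, h * t < r := by
  have h1 : ∀ c b : ℝ, 0 < b → ∀ᶠ h : ℝ in 𝓝[>] 0, h * c < b := fun c b hb => by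
    have : Tendsto (fun h : ℝ => h * c) (𝓝[>] 0) (𝓝 0) := by
      have : Tendsto (fun h : ℝ => h * c) (𝓝 0) (𝓝 (0 * c)) := tendsto_id.mul_const c
      rw [zero_mul] at this
      exact this.mono_left nhdsWithin_le_nhds
    exact this.eventually_lt_const hb
  have h2 := (h1 K ε hε).and ((h1 1 1 one_pos).and
    ((s.eventually_all.2 fun t _ => h1 t r hr).and self_mem_nhdsWithin))
  obtain ⟨h, ha, hb, hc, hd⟩ := h2.exists
  exact ⟨h, hd, by linarith, ha.le, hc⟩

/-- A cubature formula with at most `(d + 1) ^ j` nodes near `x₀` that almost integrates the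
Taylor polynomials of degree `j` at `x₀` over the part of `D` in a ball around `x₀`. -/
theorem exists_cubature {k j : ℕ} (hj : j ≤ k) {D : Set (EuclideanSpace ℝ (Fin d))}
    (ho : IsOpen D) (hc : Convex ℝ D) (hvol : volume D = 1) {L : ℕ → ℝ} (hL : 0 ≤ L j)
    {x₀ : EuclideanSpace ℝ (Fin d)} (hx₀ : x₀ ∈ D) {ρ : ℝ} {ε : ℝ} (hε : 0 < ε) :
    ∃ (n : ℕ) (p : Fin n → EuclideanSpace ℝ (Fin d)) (w : Fin n → ℝ), n ≤ (d + 1) ^ j ∧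
      (∀ i, p i ∈ D) ∧ ∀ f ∈ smoothClass k D L, |(∫ x in D, f x) - ∑ i, w i * f (p i)| ≤
        L j * |ρ| ^ (j + 1) + volume.real {y ∈ D | ρ ≤ ‖y - x₀‖} + ε := by
  obtain ⟨y, l, hl, hinterp⟩ := exists_unisolvent (polyFun (Fin d) j)
  choose C hC hCl using fun i => exists_bound_of_mem_polyFun (hl i)
  obtain ⟨r, hr, hball⟩ := Metric.isOpen_iff.1 ho x₀ hx₀
  set M := max 1 |ρ| with hM
  -- Weight bound times Taylor error at the nodes, summed, is `h * K`: the powers `h ^ (-j)` and `h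
  -- ^ (j + 1)` leave a single `h`.
  set K := ∑ i, C i * M ^ j * (L j * ‖y i‖ ^ (j + 1)) with hK
  obtain ⟨h, h0, h1, hhK, hhr⟩ := exists_scale (Finset.univ.image fun i => ‖y i‖) (K := K) hε hr
  have hM1 : 1 ≤ M := le_max_left _ _
  have hnode : ∀ i, x₀ + h • y i ∈ D := fun i => hball (by
    rw [mem_ball_iff_norm, add_sub_cancel_left, norm_smul, Real.norm_of_nonneg h0.le]
    exact hhr _ (Finset.mem_image_of_mem _ (Finset.mem_univ i)))
  set B := D ∩ Metric.ball x₀ ρ with hB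
  have hDfin : volume D < ∞ := by simp [hvol]
  have hBfin : volume B < ∞ := (measure_mono Set.inter_subset_left).trans_lt hDfin
  have hB1 : volume.real B ≤ 1 := by
    have := measureReal_mono (μ := volume) (Set.inter_subset_left (s := D)
      (t := Metric.ball x₀ ρ)) hDfin.ne
    rwa [measureReal_def _ D, hvol, ENNReal.toReal_one] at this
  have hBnorm : ∀ x ∈ B, ‖x - x₀‖ ≤ |ρ| := fun x hx =>
    (mem_ball_iff_norm.1 hx.2).le.trans (le_abs_self ρ)
  have hlB : ∀ i, ∀ x ∈ B, ‖l i (h⁻¹ • (x - x₀))‖ ≤ C i * (h⁻¹ ^ j * M ^ j) := fun i x hx => by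
    refine (hCl i _).trans (mul_le_mul_of_nonneg_left ?_ (hC i))
    rw [← mul_pow]
    refine pow_le_pow_left₀ (by positivity) (max_le ?_ ?_) j
    · exact one_le_mul_of_one_le_of_one_le ((one_le_inv₀ h0).2 h1) hM1
    · rw [norm_smul, Real.norm_of_nonneg (by positivity)]
      exact mul_le_mul_of_nonneg_left ((hBnorm x hx).trans (le_max_right _ _)) (by positivity)
  have hlc : ∀ i, Continuous fun x => l i (h⁻¹ • (x - x₀)) := fun i => by
    have := continuous_of_mem_polyFun (hl i)
    fun_prop
  have hBm : MeasurableSet B := ho.measurableSet.inter measurableSet_ball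
  have hlint : ∀ i, IntegrableOn (fun x => l i (h⁻¹ • (x - x₀))) B := fun i =>
    IntegrableOn.of_bound hBfin (hlc i).aestronglyMeasurable _
      ((ae_restrict_iff' hBm).2 (.of_forall (hlB i)))
  set w : Fin _ → ℝ := fun i => ∫ x in B, l i (h⁻¹ • (x - x₀)) with hw
  have hwle : ∀ i, |w i| ≤ C i * (h⁻¹ ^ j * M ^ j) := fun i =>
    (norm_setIntegral_le_of_norm_le_const hBfin (hlB i)).trans
      (mul_le_of_le_one_right (mul_nonneg (hC i) (by positivity)) hB1)
  refine ⟨_, fun i => x₀ + h • y i, w, ?_, hnode, fun f hf => ?_⟩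
  · simpa using finrank_polyFun_le (ι := Fin d) j
  obtain ⟨hfC, hf1, hflip⟩ := hf
  have hfj : ContDiffOn ℝ j f D := hfC.of_le (by exact_mod_cast hj)
  set T : EuclideanSpace ℝ (Fin d) → ℝ := fun x => ∑ i ∈ Finset.range (j + 1),
    (1 / i.factorial : ℝ) * iteratedFDeriv ℝ i f x₀ (fun _ => x - x₀) with hT
  have hTaylor : ∀ x ∈ D, |f x - T x| ≤ L j * ‖x - x₀‖ ^ (j + 1) := fun x hx =>
    abs_sub_taylor_le ho hc hfj hx₀ hx hL fun z hz => hflip j hj z hz x₀ hx₀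
  have hTpoly : (fun z => T (x₀ + h • z)) ∈ polyFun (Fin d) j := by
    have : (fun z => T (x₀ + h • z)) = ∑ i ∈ Finset.range (j + 1), fun z =>
        ((1 / i.factorial * h ^ i : ℝ) • (iteratedFDeriv ℝ i f x₀).toMultilinearMap) fun _ => z := by
      ext z
      rw [Finset.sum_apply]
      refine Finset.sum_congr rfl fun i _ => ?_
      rw [_root_.smul_apply, smul_eq_mul, mul_assoc]
      simp only [add_sub_cancel_left]
      congr 1
      have := (iteratedFDeriv ℝ i f x₀).map_smul_univ (fun _ => h) fun _ => z
      simpa using this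
    rw [this]
    exact Submodule.sum_mem _ fun i hi => multilinear_mem_polyFun (Finset.mem_range_succ_iff.1 hi) _
  have hTx : ∀ x, T x = ∑ i, T (x₀ + h • y i) * l i (h⁻¹ • (x - x₀)) := fun x => by
    have := hinterp _ hTpoly (h⁻¹ • (x - x₀))
    rwa [smul_inv_smul₀ h0.ne', add_sub_cancel] at this
  have hTint : ∫ x in B, T x = ∑ i, w i * T (x₀ + h • y i) := by
    rw [setIntegral_congr_fun hBm fun x _ => hTx x,
      integral_finsetSum _ fun i _ => (hlint i).const_mul _]
    simp only [integral_const_mul]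
    exact Finset.sum_congr rfl fun i _ => mul_comm _ _
  have hTintB : IntegrableOn T B := by
    have : T = fun x => ∑ i, T (x₀ + h • y i) * l i (h⁻¹ • (x - x₀)) := funext hTx
    rw [this]
    exact integrable_finsetSum _ fun i _ => (hlint i).const_mul _
  have hfint : IntegrableOn f D := IntegrableOn.of_bound hDfin
    (hfC.continuousOn.aestronglyMeasurable ho.measurableSet) 1
    ((ae_restrict_iff' ho.measurableSet).2 (.of_forall hf1))
  have e1 : |(∫ x in B, f x) - ∫ x in B, T x| ≤ L j * |ρ| ^ (j + 1) := by
    rw [← integral_sub (hfint.mono_set Set.inter_subset_left) hTintB, ← Real.norm_eq_abs]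
    refine (norm_setIntegral_le_of_norm_le_const (C := L j * |ρ| ^ (j + 1)) hBfin
      fun x hx => ?_).trans (mul_le_of_le_one_right (by positivity) hB1)
    exact (hTaylor x hx.1).trans (mul_le_mul_of_nonneg_left
      (pow_le_pow_left₀ (norm_nonneg _) (hBnorm x hx) _) hL)
  have e2 : |∫ x in D \ Metric.ball x₀ ρ, f x| ≤ volume.real {y ∈ D | ρ ≤ ‖y - x₀‖} := by
    have hset : D \ Metric.ball x₀ ρ = {y ∈ D | ρ ≤ ‖y - x₀‖} := by
      ext z
      simp [dist_eq_norm]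
    rw [← hset, ← one_mul (volume.real _), ← Real.norm_eq_abs]
    exact norm_setIntegral_le_of_norm_le_const
      ((measure_mono Set.sdiff_subset).trans_lt hDfin) fun x hx => hf1 x hx.1
  have e3 : |∑ i, w i * T (x₀ + h • y i) - ∑ i, w i * f (x₀ + h • y i)| ≤ ε := by
    rw [← Finset.sum_sub_distrib]
    refine (Finset.abs_sum_le_sum_abs _ _).trans (le_trans ?_ hhK)
    rw [hK, Finset.mul_sum]
    refine Finset.sum_le_sum fun i _ => ?_
    rw [← mul_sub, abs_mul, abs_sub_comm]
    have h2 := hTaylor _ (hnode i)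
    rw [add_sub_cancel_left, norm_smul, Real.norm_of_nonneg h0.le, mul_pow] at h2
    refine (mul_le_mul (hwle i) h2 (abs_nonneg _) (mul_nonneg (hC i) (by positivity))).trans_eq ?_
    rw [inv_pow, pow_succ h j]
    field_simp
  have e4 : ∫ x in D, f x = (∫ x in B, f x) + ∫ x in D \ Metric.ball x₀ ρ, f x :=
    (integral_inter_add_sdiff measurableSet_ball hfint).symm
  rw [e4]
  rw [hTint] at e1
  rw [abs_le] at e1 e2 e3 ⊢
  constructor <;> linarith [e1.1, e1.2, e2.1, e2.2, e3.1, e3.2]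

theorem eventually_infoComplexity_le {k j : ℕ} (hj : j ≤ k) {L : ℕ → ℕ → ℝ}
    (hL : ∀ d, 1 ≤ d → 0 < L j d) {D : (d : ℕ) → Set (EuclideanSpace ℝ (Fin d))}
    (hD : OpenUnitVolume D) (hconv : ∀ d, 1 ≤ d → Convex ℝ (D d)) (hP : Concentrated D)
    (hlim : Tendsto (fun d : ℕ => L j d * (d : ℝ) ^ (((j : ℝ) + 1) / 2)) atTop (𝓝 0))
    {ε : ℝ} (hε : 0 < ε) :
    ∀ᶠ d : ℕ in atTop, ((infoComplexity (D d) (smoothClass k (D d) fun j => L j d) ε : ℕ∞) : ℝ≥0∞) ≤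
      ENNReal.ofReal (Real.exp 1 ^ j * (d : ℝ) ^ j) := by
  obtain ⟨x, R, hx, hR⟩ := hP
  have h1 : Tendsto (fun d : ℕ => volume.real {y ∈ D d | R * √(d : ℝ) ≤ ‖y - x d‖}) atTop (𝓝 0) :=
    (ENNReal.tendsto_toReal ENNReal.zero_ne_top).comp hR
  have h2 : Tendsto (fun d : ℕ => L j d * |R * √(d : ℝ)| ^ (j + 1)) atTop (𝓝 0) := by
    have := hlim.const_mul (|R| ^ (j + 1))
    rw [mul_zero] at this
    refine this.congr fun d => ?_
    rw [abs_mul, abs_of_nonneg (Real.sqrt_nonneg _), mul_pow, Real.sqrt_eq_rpow,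
      ← Real.rpow_natCast ((d : ℝ) ^ (1 / 2 : ℝ)), ← Real.rpow_mul (Nat.cast_nonneg d)]
    push_cast
    ring_nf
  filter_upwards [h1.eventually_lt_const (show 0 < ε / 3 by positivity),
    h2.eventually_lt_const (show 0 < ε / 3 by positivity), eventually_ge_atTop 1] with d hd1 hd2 hd
  obtain ⟨n, p, w, hn, hp, herr⟩ := exists_cubature (L := fun j => L j d) hj (hD d hd).1 (hconv d hd)
    (hD d hd).2 (hL d hd).le (hx d hd) (ρ := R * √d) (show 0 < ε / 3 by positivity)
  have hle := infoComplexity_le_of_cubature (F := smoothClass k (D d) fun j => L j d) hε.le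
    ⟨_, hx d hd⟩ p hp w fun f hf => (herr f hf).trans (by linarith)
  have hle' : ((infoComplexity (D d) (smoothClass k (D d) fun j => L j d) ε : ℕ∞) : ℝ≥0∞) ≤
      ((n : ℕ∞) : ℝ≥0∞) := ENat.toENNReal_le.2 hle
  refine hle'.trans ?_
  rw [ENat.toENNReal_coe, ← ENNReal.ofReal_natCast, ← mul_pow]
  refine ENNReal.ofReal_le_ofReal ?_
  have hd' : (1 : ℝ) ≤ d := by exact_mod_cast hd
  -- This gives `d + 1 ≤ 2 * d ≤ e * d`.
  have he : (2 : ℝ) ≤ Real.exp 1 := by linarith [Real.add_one_le_exp (1 : ℝ)]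
  calc (n : ℝ) ≤ ((d : ℝ) + 1) ^ j := by exact_mod_cast hn
    _ ≤ (Real.exp 1 * d) ^ j := pow_le_pow_left₀ (by positivity) (by nlinarith) j

/-- The curse of dimensionality is excluded by a polynomial upper bound for the complexity. -/
theorem not_curse_of_eventually_le {D : (d : ℕ) → Set (EuclideanSpace ℝ (Fin d))}
    {F : (d : ℕ) → Set (EuclideanSpace ℝ (Fin d) → ℝ)} {a : ℝ} {j : ℕ}
    (h : ∀ ε : ℝ, 0 < ε → ∀ᶠ d : ℕ in atTop,
      ((infoComplexity (D d) (F d) ε : ℕ∞) : ℝ≥0∞) ≤ ENNReal.ofReal (a * (d : ℝ) ^ j)) :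
    ¬ Curse D F := by
  rintro ⟨c, ε, γ, hc, hε, hγ, hcurse⟩
  have h1 : Tendsto (fun d : ℕ => a * ((d : ℝ) ^ j / (1 + γ) ^ d)) atTop (𝓝 0) := by
    simpa using (tendsto_pow_const_div_const_pow_of_one_lt j (by linarith : 1 < 1 + γ)).const_mul a
  obtain ⟨d, hd, hle, hlt⟩ :=
    ((hcurse ε hε le_rfl).and_eventually ((h ε hε).and (h1.eventually_lt_const hc))).exists
  have hpos : 0 < c * (1 + γ) ^ d := by positivity
  rw [mul_div_assoc', div_lt_iff₀ (by positivity)] at hlt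
  exact absurd (hd.trans hle) (not_le.2 ((ENNReal.ofReal_lt_ofReal_iff hpos).2 hlt))

end UpperBound

end Integration

theorem theorem5p1 (k : ℕ) (L : ℕ → ℕ → ℝ)
    (hL : ∀ j, j ≤ k → ∀ d, 1 ≤ d → 0 < L j d)
    (D : (d : ℕ) → Set (EuclideanSpace ℝ (Fin d))) :
    (((∀ d, 1 ≤ d → D d = Integration.unitCube d) ∨
          (Integration.OpenUnitVolume D ∧ Integration.SmallRadius D)) →
        0 < limsup (fun d : ℕ => min ((L 0 d * √(d : ℝ) : ℝ) : EReal)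
          (⨅ j ∈ Finset.Icc 1 k, ((L j d * (d : ℝ) : ℝ) : EReal))) atTop →
        Integration.Curse D
          (fun d => Integration.smoothClass k (D d) (fun j => L j d))) ∧
    (Integration.OpenUnitVolume D → (∀ d, 1 ≤ d → Convex ℝ (D d)) →
        Integration.Concentrated D →
        ∀ j ≤ k,
          Tendsto (fun d : ℕ => L j d * (d : ℝ) ^ (((j : ℝ) + 1) / 2)) atTop (𝓝 0) →
          ¬ Integration.Curse D
              (fun d => Integration.smoothClass k (D d) (fun j => L j d)) ∧
          ∀ ε : ℝ, 0 < ε → ε < 1 → ∀ᶠ d : ℕ in atTop,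
            ((Integration.infoComplexity (D d)
                (Integration.smoothClass k (D d) (fun j => L j d)) ε : ℕ∞) : ℝ≥0∞) ≤
              ENNReal.ofReal (Real.exp 1 ^ j * (d : ℝ) ^ j)) := by
  refine ⟨Integration.curse_of_limsup_pos, fun hD hconv hP j hj hlim => ?_⟩
  have h : ∀ ε : ℝ, 0 < ε → _ := fun ε hε =>
    Integration.eventually_infoComplexity_le hj (hL j hj) hD hconv hP hlim hε
  exact ⟨Integration.not_curse_of_eventually_le h, fun ε hε _ => h ε hε⟩
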